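/- **Setting.** For $0\le\alpha<1$ and $\theta>-\alpha$, let $PD(\alpha,\theta)$ be the law of the decreasing rearrangement of the sequence $\hat f_j=(1-Y_1)\cdots(1-Y_{j-1})Y_j$, $j\ge 1$, where $Y_1,Y_2,\dots$ are independent and $Y_j$ has the beta law $\beta(1-\alpha,\theta+j\alpha)$. Given a random sequence $s_1\ge s_2\ge\dots\ge 0$ with $\sum_i s_i\le 1$ and independent uniform variables $U_1,U_2,\dots$ on $[0,1]$, independent of it, the paint-box partition of $\mathbb N=\{1,2,\dots\}$ puts $i\ne j$ in the same block iff $U_i$ and $U_j$ belong to the same interval $[s_1+\dots+s_{l-1},\,s_1+\dots+s_l)$, $l\ge 1$. For $t\in(0,1)$ let $q_t$ be the EPPF of the paint-box partition $\Gamma$ of a $PD(t,0)$ sequence, i.e. $q_t(n_1,\dots,n_k)$ is the probability that the restriction $\Gamma_{|n}$ of $\Gamma$ to $[n]=\{1,\dots,n\}$, $n=n_1+\dots+n_k$, equals a given partition of $[n]$ with $k$ blocks of sizes $n_1,\dots,n_k$. For a probability $\rho$ on partitions of $\mathbb N$ and a partition $\pi$ of $\mathbb N$, let $\rho\text{-FRAG}(\pi,\cdot)$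 be the law of the partition obtained by splitting, for each $i$, the $i$-th block of $\pi$ (blocks being listed by increasing least element) by $\pi^{(i)}$, where $\pi^{(1)},\pi^{(2)},\dots$ are i.i.d. with law $\rho$. Ruelle's fragmentation is the Markov process $(\Pi(t),t\in[0,1))$ with values in partitions of $\mathbb N$, continuous in probability and with restrictions $\Pi_{|n}$ to $[n]$ that have right-continuous paths, such that $\Pi(0)$ is the one-block partition almost surely and, for $t\ge0$, $t'>0$, $t+t'<1$, the conditional law of $\Pi(t+t')$ given $(\Pi(u))_{u\le t}$ is $\rho_{t,t+t'}\text{-FRAG}(\Pi(t),\cdot)$, where $\rho_{t,t+t'}$ is the law of the paint-box partition of a $PD(t+t',-t)$ sequence. Let $\tau_n$ be the time of the first jump of $\Pi_{|n}$ (with $\tau_n=1$ if it does not jump in $[0,1)$). **Proposition.** Let $\pi$ be a partition of $[n]$ with $k\ge 2$ blocks, of sizes $n_1,\dots,n_k$. Then $\mathbb P(\tau_n\ge t)>0$ for all $t\in[0,1)$, $\tau_n<1$ almost surely, $\tau_n$ has a density $g_n$ that is continuous on $[0,1)$, the conditional probability $h_\pi^n(t)=\mathbb P(\Pi_{|n}(\tau_n)=\pi\mid\tau_n=t)$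 has a version that is continuous on $[0,1)$, and for every $t\in[0,1)$ the instantaneous jump rate $$q_{\pi,t}:=h^n_\pi(t)\,\frac{g_n(t)}{\mathbb P(\tau_n\ge t)}=\lim_{s\to0+}\frac1s\,\mathbb P\big(\Pi_{|n}(\tau_n)=\pi,\ \tau_n\in[t,t+s]\ \big|\ \tau_n\ge t\big)$$ exists. For every $t\in(0,1)$, $q_t(n)>0$ and $$q_{\pi,t}=\frac{q_t(n_1,\dots,n_k)}{t\,(k-1)\,q_t(n)},$$ and for $t=0$ the formula holds in the limit: $q_{\pi,0}=\lim_{t\to0+}\dfrac{q_t(n_1,\dots,n_k)}{t\,(k-1)\,q_t(n)}$. -/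

import Mathlib

open MeasureTheory ProbabilityTheory Set Filter Topology

/-! ### Partitions

A partition of a set is an equivalence relation (`Setoid`), so that its blocks are `Setoid.classes`
and the partition with a single block is `⊤`. The positive integers are
relabelled as `ℕ = {0, 1, …}` and `[n]` as `Fin n`. -/

/-- The σ-algebra on partitions generated by the events `i ∼ j`. On partitions of `ℕ`, this is the
Borel σ-algebra of the usual distance, generated by the restrictions to `[n]`. -/
instance partitionMeasurableSpace {α : Type*} : MeasurableSpace (Setoid α) :=
  MeasurableSpace.comap (fun π : Setoid α => fun i j : α => π i j) inferInstance

theorem measurable_partition {α Ω : Type*} [MeasurableSpace Ω] {f : Ω → Setoid α}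
    (h : ∀ i j, MeasurableSet {ω | f ω i j}) : Measurable f := by
  refine measurable_iff_comap_le.2 ?_
  unfold partitionMeasurableSpace
  rw [MeasurableSpace.comap_comp]
  refine measurable_iff_comap_le.1 ?_
  refine measurable_pi_iff.2 fun i => measurable_pi_iff.2 fun j => ?_
  exact measurableSet_setOfPred.1 (h i j)

theorem measurableSet_partition_rel {α : Type*} (i j : α) :
    MeasurableSet {π : Setoid α | π i j} := by
  have h : Measurable (fun π : Setoid α => fun i j : α => π i j) :=
    comap_measurable _
  exact measurableSet_setOfPred.2 (measurable_pi_iff.1 (measurable_pi_iff.1 h i) j)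

/-- The restriction of a partition of the integers to `[n]`. -/
def partitionRestrict (n : ℕ) (π : Setoid ℕ) : Setoid (Fin n) :=
  Setoid.comap (fun i : Fin n => (i : ℕ)) π

/-! ### Poisson–Dirichlet laws -/

/-- The beta law with parameters `a, b > 0` (completed arbitrarily by `δ₁` for other
parameters). -/
noncomputable def betaLaw (a b : ℝ) : Measure ℝ :=
  open Classical in if 0 < a ∧ 0 < b then betaMeasure a b else Measure.dirac 1

instance isProbabilityMeasure_betaLaw (a b : ℝ) : IsProbabilityMeasure (betaLaw a b) := by
  unfold betaLaw
  split_ifs with h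
  · exact isProbabilityMeasureBeta h.1 h.2
  · infer_instance

/-- Stick breaking: `f n = (1 - Y 0) ⋯ (1 - Y (n - 1)) Y n`. -/
def stickBreaking (Y : ℕ → ℝ) (n : ℕ) : ℝ :=
  (∏ i ∈ Finset.range n, (1 - Y i)) * Y n

theorem measurable_stickBreaking : Measurable stickBreaking := by
  refine measurable_pi_iff.2 fun n => ?_
  unfold stickBreaking
  fun_prop

/-- The decreasing rearrangement of a sequence of non-negative numbers tending to `0`: its term of
index `n` is the `(n + 1)`-th largest value, counted with multiplicity, i.e. the largest `x` such
that some `n + 1` indices carry values `≥ x`. -/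
noncomputable def decreasingRearrangement (f : ℕ → ℝ) (n : ℕ) : ℝ :=
  ⨆ s : {s : Finset ℕ // s.card = n + 1},
    s.1.inf' (Finset.card_pos.1 (by have h := s.2; omega)) f

theorem measurable_decreasingRearrangement : Measurable decreasingRearrangement := by
  refine measurable_pi_iff.2 fun n => ?_
  unfold decreasingRearrangement
  refine Measurable.iSup fun s => ?_
  have h : ∀ (t : Finset ℕ) (ht : t.Nonempty), Measurable fun g : ℕ → ℝ => t.inf' ht g := by
    intro t ht
    induction ht using Finset.Nonempty.cons_induction with
    | singleton a => simpa using measurable_pi_apply a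
    | cons a t ha ht ih =>
      have h1 : (fun g : ℕ → ℝ => (Finset.cons a t ha).inf' (by simp) g) =
          fun g => min (g a) (t.inf' ht g) := by
        funext g
        exact Finset.inf'_cons ht (f := g) (hb := ha)
      rw [h1]
      exact (measurable_pi_apply a).min ih
  exact h s.1 _

/-- The law of the sequence `f` obtained by stick breaking from independent variables `Y₁, Y₂, …`
with `Yₙ` of law `β(1 - α, θ + n α)`. -/
noncomputable def stickBreakingLaw (α θ : ℝ) : Measure (ℕ → ℝ) :=
  (Measure.infinitePi fun n : ℕ => betaLaw (1 - α) (θ + (n + 1) * α)).map stickBreaking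

instance isProbabilityMeasure_stickBreakingLaw (α θ : ℝ) :
    IsProbabilityMeasure (stickBreakingLaw α θ) :=
  Measure.isProbabilityMeasure_map measurable_stickBreaking.aemeasurable

/-- The Poisson–Dirichlet law `PD(α, θ)`, for `0 ≤ α < 1` and `θ > -α`. -/
noncomputable def poissonDirichlet (α θ : ℝ) : Measure (ℕ → ℝ) :=
  (stickBreakingLaw α θ).map decreasingRearrangement

instance isProbabilityMeasure_poissonDirichlet (α θ : ℝ) :
    IsProbabilityMeasure (poissonDirichlet α θ) :=
  Measure.isProbabilityMeasure_map measurable_decreasingRearrangement.aemeasurable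

/-! ### The paint-box construction -/

/-- The indices `k` such that `s 0 + ⋯ + s (k - 1) ≤ u < s 0 + ⋯ + s k`. There is at most one of
them when `s` is non-negative. -/
def paintBoxCell (s : ℕ → ℝ) (u : ℝ) : Set ℕ :=
  {k | ∑ l ∈ Finset.range k, s l ≤ u ∧ u < ∑ l ∈ Finset.range (k + 1), s l}

/-- The partition in which `i ≠ j` are in the same block iff `U i` and `U j` fall in the same
interval `[s 0 + ⋯ + s (k - 1), s 0 + ⋯ + s k)`. -/
def paintBox (s : ℕ → ℝ) (U : ℕ → ℝ) : Setoid ℕ where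
  r i j := i = j ∨
    ((paintBoxCell s (U i)).Nonempty ∧ paintBoxCell s (U i) = paintBoxCell s (U j))
  iseqv := by
    refine ⟨fun i => Or.inl rfl, ?_, ?_⟩
    · rintro i j (h | ⟨h, h'⟩)
      · exact Or.inl h.symm
      · exact Or.inr ⟨h' ▸ h, h'.symm⟩
    · rintro i j k (rfl | ⟨h, h'⟩) (rfl | ⟨h1, h1'⟩)
      · exact Or.inl rfl
      · exact Or.inr ⟨h1, h1'⟩
      · exact Or.inr ⟨h, h'⟩
      · exact Or.inr ⟨h, h'.trans h1'⟩

theorem measurable_paintBox :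
    Measurable (fun p : (ℕ → ℝ) × (ℕ → unitInterval) =>
      paintBox p.1 (fun i => (p.2 i : ℝ))) := by
  have hcell : ∀ i k : ℕ, MeasurableSet {p : (ℕ → ℝ) × (ℕ → unitInterval) |
      k ∈ paintBoxCell p.1 (p.2 i : ℝ)} := by
    intro i k
    have hs : ∀ m : ℕ, Measurable (fun p : (ℕ → ℝ) × (ℕ → unitInterval) =>
        ∑ l ∈ Finset.range m, p.1 l) := fun m => by fun_prop
    have hu : Measurable (fun p : (ℕ → ℝ) × (ℕ → unitInterval) => (p.2 i : ℝ)) := by fun_prop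
    exact (measurableSet_le (hs k) hu).inter (measurableSet_lt hu (hs (k + 1)))
  refine measurable_partition fun i j => ?_
  have h1 : MeasurableSet {p : (ℕ → ℝ) × (ℕ → unitInterval) |
      (paintBoxCell p.1 (p.2 i : ℝ)).Nonempty} := by
    simp only [Set.Nonempty, Set.ofPred_exists]
    exact MeasurableSet.iUnion fun k => hcell i k
  have h2 : MeasurableSet {p : (ℕ → ℝ) × (ℕ → unitInterval) |
      paintBoxCell p.1 (p.2 i : ℝ) = paintBoxCell p.1 (p.2 j : ℝ)} := by
    simp only [Set.ext_iff, Set.ofPred_forall]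
    refine MeasurableSet.iInter fun k => ?_
    exact measurableSet_setOfPred.2
      ((measurableSet_setOfPred.1 (hcell i k)).iff (measurableSet_setOfPred.1 (hcell j k)))
  exact (MeasurableSet.const (i = j)).union (h1.inter h2)

/-- The law of the exchangeable random partition obtained by the paint-box construction from a
random mass-partition of law `μ` and independent uniform variables on `[0, 1]`. -/
noncomputable def paintBoxLaw (μ : Measure (ℕ → ℝ)) : Measure (Setoid ℕ) :=
  (μ.prod (Measure.infinitePi fun _ : ℕ => (volume : Measure unitInterval))).map
    (fun p => paintBox p.1 (fun i => (p.2 i : ℝ)))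

instance isProbabilityMeasure_paintBoxLaw (μ : Measure (ℕ → ℝ)) [IsProbabilityMeasure μ] :
    IsProbabilityMeasure (paintBoxLaw μ) :=
  Measure.isProbabilityMeasure_map measurable_paintBox.aemeasurable

/-- The partition of `[m 0 + ⋯ + m (k - 1)]` into consecutive blocks of sizes
`m 0, …, m (k - 1)`. -/
def consecutivePartition {k : ℕ} (m : Fin k → ℕ) : Setoid (Fin (∑ i, m i)) :=
  Setoid.ker fun x => (finSigmaFinEquiv.symm x).1

/-- The exchangeable partition probability function of an exchangeable law `ρ` on partitions of
the integers: the probability that the restriction to `[m 0 + ⋯ + m (k - 1)]` is a given partition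
with `k` blocks of sizes `m 0, …, m (k - 1)`. -/
noncomputable def eppf (ρ : Measure (Setoid ℕ)) {k : ℕ} (m : Fin k → ℕ) : ℝ :=
  ρ.real {π | partitionRestrict (∑ i, m i) π = consecutivePartition m}

/-! ### Fragmentation -/

/-- The least element of the block of `i`. -/
noncomputable def blockMin (π : Setoid ℕ) (i : ℕ) : ℕ := sInf {j | π i j}

/-- The label (starting from `0`) of the block of `i`, when the blocks are listed in the increasing
order of their least elements. -/
noncomputable def blockIndex (π : Setoid ℕ) (i : ℕ) : ℕ :=
  open Classical in Nat.count (fun m => blockMin π m = m) (blockMin π i)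

/-- The fragmentation of `π` by a sequence of partitions: the block of label `b` of `π` is
split by the `b`-th partition of the sequence. -/
noncomputable def frag (π : Setoid ℕ) (p : ℕ → Setoid ℕ) : Setoid ℕ where
  r i j := π i j ∧ p (blockIndex π i) i j
  iseqv := by
    have key : ∀ {i j}, π i j → blockIndex π i = blockIndex π j := by
      intro i j h
      have : blockMin π i = blockMin π j := by
        unfold blockMin
        congr 1
        ext l
        exact ⟨fun hl => π.trans' (π.symm' h) hl, fun hl => π.trans' h hl⟩
      unfold blockIndex
      rw [this]
    refine ⟨fun i => ⟨π.refl' i, Setoid.refl' _ i⟩, ?_, ?_⟩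
    · rintro i j ⟨h, h'⟩
      exact ⟨π.symm' h, by rw [← key h]; exact Setoid.symm' _ h'⟩
    · rintro i j k ⟨h, h'⟩ ⟨h1, h1'⟩
      exact ⟨π.trans' h h1, Setoid.trans' _ h' (by rw [key h]; exact h1')⟩

/-- The law `ρ-FRAG(π, ·)` of the fragmentation of `π` by an i.i.d. sequence of partitions of
law `ρ`. -/
noncomputable def fragLaw (ρ : Measure (Setoid ℕ)) [IsProbabilityMeasure ρ] (π : Setoid ℕ) :
    Measure (Setoid ℕ) :=
  (Measure.infinitePi fun _ : ℕ => ρ).map (frag π)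

/-- The σ-algebra generated by `X u`, `0 ≤ u ≤ s`. -/
abbrev pastSigmaAlgebra {Ω : Type*} (X : ℝ → Ω → Setoid ℕ) (s : ℝ) : MeasurableSpace Ω :=
  ⨆ u ∈ Icc (0 : ℝ) s, MeasurableSpace.comap (X u) partitionMeasurableSpace

/-- `(X t, t ∈ [0, 1))` is Ruelle's fragmentation with values in the partitions of the integers:
the standard exchangeable fragmentation process, i.e. the Markov process started from the
one-block partition, with semi-group `P_{t,t+t'}-FRAG`, where `P_{t,t+t'}` is the law of
the paint-box partition of a `PD(t + t', -t)` mass-partition. The restrictions to `[n]` are taken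
right-continuous, so that first jump times make sense. Times outside `[0, 1)` are irrelevant. -/
structure IsRuelleFragmentation {Ω : Type*} [MeasurableSpace Ω] (P : Measure Ω)
    (X : ℝ → Ω → Setoid ℕ) : Prop where
  measurable : ∀ t ∈ Ico (0 : ℝ) 1, Measurable (X t)
  standard : ∀ᵐ ω ∂P, X 0 ω = ⊤
  continuous_in_probability : ∀ n : ℕ, ∀ t ∈ Ico (0 : ℝ) 1,
    Tendsto (fun u => P.real {ω | partitionRestrict n (X u ω) ≠ partitionRestrict n (X t ω)})
      (𝓝[Ico 0 1] t) (𝓝 0)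
  right_continuous : ∀ᵐ ω ∂P, ∀ n : ℕ, ∀ t ∈ Ico (0 : ℝ) 1,
    ∀ᶠ u in 𝓝[>] t, partitionRestrict n (X u ω) = partitionRestrict n (X t ω)
  markov : ∀ t t' : ℝ, 0 ≤ t → 0 < t' → t + t' < 1 →
    ∀ A : Set (Setoid ℕ), MeasurableSet A →
      P⟦X (t + t') ⁻¹' A | pastSigmaAlgebra X t⟧ =ᵐ[P] fun ω =>
        (fragLaw (paintBoxLaw (poissonDirichlet (t + t') (-t))) (X t ω)).real A

/-! ### Instantaneous jump rates -/

/-- The time `τₙ` of the first jump of the restriction to `[n]` of a process started from the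
one-block partition, with the value `1` if there is no jump in `[0, 1)`. -/
noncomputable def firstJumpTime {Ω : Type*} (X : ℝ → Ω → Setoid ℕ) (n : ℕ) (ω : Ω) : ℝ :=
  sInf (insert 1 {t | t ∈ Ico (0 : ℝ) 1 ∧ partitionRestrict n (X t ω) ≠ ⊤})

/-- `q t`, `t ∈ [0, 1)`, is the instantaneous jump rate `q_{π,t}` of the process `X` to the
partition `π` of `[n]`. Here `τ` is the first jump time of the restriction to `[n]`. -/
structure IsInstantaneousJumpRate {Ω : Type*} [MeasurableSpace Ω] (P : Measure Ω)
    (X : ℝ → Ω → Setoid ℕ) {n : ℕ} (π : Setoid (Fin n)) (q : ℝ → ℝ) : Prop where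
  /-- `P(τ ≥ t) > 0` for `t < 1`. -/
  survival_pos : ∀ t ∈ Ico (0 : ℝ) 1, 0 < P {ω | t ≤ firstJumpTime X n ω}
  /-- `τ < 1` almost surely. -/
  jump_lt_one : ∀ᵐ ω ∂P, firstJumpTime X n ω < 1
  /-- `τ` has a continuous density `g`, the conditional probability
  `h t = P(X t restricted to [n] is π | τ = t)` has a continuous version, and
  `q t = h t * g t / P(τ ≥ t)`. -/
  density : ∃ g h : ℝ → ℝ,
    ContinuousOn g (Ico 0 1) ∧ (∀ t ∈ Ico (0 : ℝ) 1, 0 ≤ g t) ∧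
    (∀ A ⊆ Ico (0 : ℝ) 1, MeasurableSet A →
      P {ω | firstJumpTime X n ω ∈ A} = ∫⁻ t in A, ENNReal.ofReal (g t)) ∧
    ContinuousOn h (Ico 0 1) ∧ (∀ t ∈ Ico (0 : ℝ) 1, h t ∈ Icc 0 1) ∧
    (∀ A ⊆ Ico (0 : ℝ) 1, MeasurableSet A →
      P {ω | firstJumpTime X n ω ∈ A ∧
          partitionRestrict n (X (firstJumpTime X n ω) ω) = π} =
        ∫⁻ t in A, ENNReal.ofReal (h t * g t)) ∧
    ∀ t ∈ Ico (0 : ℝ) 1, q t = h t * (g t / P.real {ω | t ≤ firstJumpTime X n ω})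
  /-- `q t` is the limit, as `s → 0+`, of `s⁻¹ P(X τ restricted to [n] is π, and τ ∈ [t, t + s] | τ ≥ t)`. -/
  limit : ∀ t ∈ Ico (0 : ℝ) 1,
    Tendsto (fun s : ℝ => s⁻¹ * (P[|{ω | t ≤ firstJumpTime X n ω}]).real
        {ω | firstJumpTime X n ω ∈ Icc t (t + s) ∧
          partitionRestrict n (X (firstJumpTime X n ω) ω) = π})
      (𝓝[>] 0) (𝓝 (q t))

/-! The proof rests on Pitman's sampling formula: for α > 0 and θ > -α, the paint-box partition of a
PD(α, θ) sequence has EPPF ∏_{1≤i<k} (θ + iα) · ∏_j (1-α)_{m_j-1} / (θ+1)_{n-1}, where (x)_r is the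
rising factorial.

Suppose that Π(u) is still trivial on [n]. Only the first partition of the i.i.d. sequence then acts
on [n], so Π(v) restricted to [n] is distributed as a PD(v, -u) paint-box partition. For θ = -u the
factor i = 1 of the formula is v - u, and the denominator (1-u)_{n-1} cancels against P(τ_n > u) =
(1-u)_{n-1}/(n-1)!. Hence P(Π(u) trivial on [n], Π(v) = π on [n]) is exactly (v-u) ψ(u, v) with ψ a
polynomial (`survival_mul_pitmanEPPF`). Summing over finer and finer subdivisions and using
right-continuity, the law of τ_n on the event of a jump to π has density ψ(t, t), so the jump rate
is ψ(t, t) / P(τ_n ≥ t). Now P(τ_n ≥ t) = q_t(n). For θ = 0, the product over i is (k-1)! t^{k-1},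
while the corresponding product in ψ(t, t) is (k-2)! t^{k-2}. The ratio t(k-1) is the factor in the
statement (`pitmanEPPF_zero_eq`).

The sampling formula is an identity for the expected sum of ∏ f(e_j)^{m_j} over distinct indices.
Isolating the first stick, and using that the rest is a rescaled stick breaking with θ + α in place
of θ, gives a recursion in (k, θ) (`lintegral_distinctSum_recursion`). Pitman's expression satisfies
the same recursion. By induction on k the difference solves a homogeneous recursion in θ and is
bounded for θ ≥ 0, hence vanishes because the harmonic series diverges
(`eq_zero_of_risingFactorial_recursion`). The sum is unchanged by decreasing rearrangement, and it
is the conditional paint-box probability once the masses add up to 1. This last fact is the case of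
a single block of size 1. -/

/-! ### Pitman's sampling formula -/

/-- The rising factorial `x (x + 1) ⋯ (x + n - 1)`. -/
def risingFactorial (x : ℝ) (n : ℕ) : ℝ := ∏ i ∈ Finset.range n, (x + i)

theorem risingFactorial_zero (x : ℝ) : risingFactorial x 0 = 1 := by
  simp [risingFactorial]

theorem risingFactorial_succ (x : ℝ) (n : ℕ) :
    risingFactorial x (n + 1) = risingFactorial x n * (x + n) := by
  simp [risingFactorial, Finset.prod_range_succ]

theorem risingFactorial_succ' (x : ℝ) (n : ℕ) :
    risingFactorial x (n + 1) = x * risingFactorial (x + 1) n := by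
  rw [risingFactorial, Finset.prod_range_succ', mul_comm, risingFactorial]
  congr 1
  · simp
  · refine Finset.prod_congr rfl fun i _ => ?_
    push_cast
    ring

theorem risingFactorial_pos {x : ℝ} (hx : 0 < x) (n : ℕ) : 0 < risingFactorial x n :=
  Finset.prod_pos fun i _ => by positivity

theorem risingFactorial_le {x y : ℝ} (hx : 0 ≤ x) (hxy : x ≤ y) (n : ℕ) :
    risingFactorial x n ≤ risingFactorial y n :=
  Finset.prod_le_prod (fun i _ => by positivity) fun i _ => by linarith

theorem risingFactorial_mono {x : ℝ} (hx : 1 ≤ x) : Monotone (risingFactorial x) := by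
  refine monotone_nat_of_le_succ fun n => ?_
  rw [risingFactorial_succ]
  have h := risingFactorial_pos (zero_lt_one.trans_le hx) n
  have h' : (0 : ℝ) ≤ n := n.cast_nonneg
  nlinarith

/-- Pitman's formula for the exchangeable partition probability function of `PD(α, θ)`. -/
noncomputable def pitmanEPPF (α θ : ℝ) {k : ℕ} (m : Fin k → ℕ) : ℝ :=
  (∏ i ∈ Finset.range (k - 1), (θ + (i + 1) * α)) / risingFactorial (θ + 1) (∑ j, m j - 1) *
    ∏ j, risingFactorial (1 - α) (m j - 1)

/-- The first factor of (θ+α)_N completes the product over i, and the others cancel the denominator.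
The resulting form also covers k = 0, which occurs in the recursion when the only block is removed.
-/
theorem risingFactorial_mul_pitmanEPPF {α θ : ℝ} (hθ : -α < θ) {k : ℕ}
    (m : Fin k → ℕ) (hm : ∀ j, 0 < m j) :
    risingFactorial (θ + α) (∑ j, m j) * pitmanEPPF α (θ + α) m =
      (∏ i ∈ Finset.range k, (θ + (i + 1) * α)) * ∏ j, risingFactorial (1 - α) (m j - 1) := by
  cases k with
  | zero => simp [pitmanEPPF, risingFactorial_zero]
  | succ k =>
    obtain ⟨N, hN⟩ : ∃ N, ∑ j, m j = N + 1 := by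
      refine Nat.exists_eq_succ_of_ne_zero ?_
      have : 0 < ∑ j, m j := Finset.sum_pos (fun j _ => hm j) Finset.univ_nonempty
      omega
    have hp := (risingFactorial_pos (show 0 < θ + α + 1 by linarith) N).ne'
    rw [pitmanEPPF, hN, risingFactorial_succ', Finset.prod_range_succ']
    simp only [Nat.add_sub_cancel]
    have : ∏ i ∈ Finset.range k, (θ + α + (i + 1) * α) =
        ∏ i ∈ Finset.range k, (θ + (((i + 1 : ℕ) : ℝ) + 1) * α) :=
      Finset.prod_congr rfl fun i _ => by push_cast; ring
    rw [this]
    field_simp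
    push_cast
    ring

/-- The recursion satisfied by Pitman's formula, according to the size of the block that contains
the first size-biased pick. -/
theorem pitmanEPPF_recursion {α θ : ℝ} (hα1 : α < 1) (hθ : -α < θ) {k : ℕ}
    (m : Fin (k + 1) → ℕ) (hm : ∀ j, 0 < m j) :
    pitmanEPPF α θ m =
      risingFactorial (θ + α) (∑ j, m j) / risingFactorial (θ + 1) (∑ j, m j) *
        pitmanEPPF α (θ + α) m +
      ∑ j, risingFactorial (1 - α) (m j) * risingFactorial (θ + α) (∑ i, m (j.succAbove i)) /
        risingFactorial (θ + 1) (∑ j, m j) * pitmanEPPF α (θ + α) (fun i => m (j.succAbove i)) := by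
  obtain ⟨N, hN⟩ : ∃ N, ∑ j, m j = N + 1 := by
    refine Nat.exists_eq_succ_of_ne_zero ?_
    have : 0 < ∑ j, m j := Finset.sum_pos (fun j _ => hm j) Finset.univ_nonempty
    omega
  have hR := (risingFactorial_pos (show 0 < θ + 1 by linarith) (∑ j, m j)).ne'
  have hR' := (risingFactorial_pos (show 0 < θ + 1 by linarith) N).ne'
  have hN1 : θ + 1 + N ≠ 0 := by have : (0 : ℝ) ≤ N := N.cast_nonneg; linarith
  set W := ∏ j, risingFactorial (1 - α) (m j - 1) with hW
  set Q := ∏ i ∈ Finset.range k, (θ + ((i : ℝ) + 1) * α) with hQ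
  have h1 : risingFactorial (θ + α) (∑ j, m j) / risingFactorial (θ + 1) (∑ j, m j) *
      pitmanEPPF α (θ + α) m =
      Q * W / risingFactorial (θ + 1) (∑ j, m j) * (θ + (k + 1) * α) := by
    rw [div_mul_eq_mul_div, risingFactorial_mul_pitmanEPPF hθ m hm, Finset.prod_range_succ]
    ring
  have h2 : ∀ j, risingFactorial (1 - α) (m j) *
      risingFactorial (θ + α) (∑ i, m (j.succAbove i)) /
        risingFactorial (θ + 1) (∑ j, m j) * pitmanEPPF α (θ + α) (fun i => m (j.succAbove i)) =
      Q * W / risingFactorial (θ + 1) (∑ j, m j) * (m j - α) := by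
    intro j
    obtain ⟨a, ha⟩ := Nat.exists_eq_succ_of_ne_zero (hm j).ne'
    have h3 := risingFactorial_mul_pitmanEPPF hθ (fun i => m (j.succAbove i)) fun i => hm _
    have h4 : W = risingFactorial (1 - α) (m j - 1) *
        ∏ i, risingFactorial (1 - α) (m (j.succAbove i) - 1) := by
      rw [hW, Fin.prod_univ_succAbove _ j]
    calc _ = risingFactorial (1 - α) (m j) * (risingFactorial (θ + α)
          (∑ i, m (j.succAbove i)) * pitmanEPPF α (θ + α) (fun i => m (j.succAbove i))) /
          risingFactorial (θ + 1) (∑ j, m j) := by ring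
      _ = _ := by
        rw [h3, h4, ha, risingFactorial_succ]
        simp only [Nat.succ_eq_add_one, Nat.add_sub_cancel]
        push_cast
        ring
  -- All terms share the factor Q W / (θ+1)_{N+1}. Their coefficients θ + (k+1)α and m_j - α add up
  -- to θ + 1 + N, the last factor of that denominator.
  have h5 : (∑ j, ((m j : ℝ) - α)) = N + 1 - (k + 1) * α := by
    rw [Finset.sum_sub_distrib, ← Nat.cast_sum, hN]
    simp
  rw [h1, Finset.sum_congr rfl fun j _ => h2 j, ← Finset.mul_sum, ← mul_add, h5, pitmanEPPF, ← hW,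
    Nat.add_sub_cancel, ← hQ, hN, Nat.add_sub_cancel, risingFactorial_succ]
  field_simp
  ring

theorem pitmanEPPF_nonneg {α θ : ℝ} (hα : 0 < α) (hα1 : α < 1) (hθ : -α < θ) {k : ℕ}
    (m : Fin k → ℕ) : 0 ≤ pitmanEPPF α θ m := by
  refine mul_nonneg (div_nonneg (Finset.prod_nonneg fun i _ => ?_)
    (risingFactorial_pos (by linarith) _).le)
    (Finset.prod_nonneg fun j _ => (risingFactorial_pos (by linarith) _).le)
  have : (0 : ℝ) ≤ i * α := by positivity
  linarith

/-- The bound does not depend on θ ≥ 0, as uniqueness in the recursion requires: θ + iα ≤ θ + i, and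
there are k - 1 ≤ n - 1 such factors. -/
theorem pitmanEPPF_le {α θ : ℝ} (hα : 0 < α) (hα1 : α < 1) (hθ : 0 ≤ θ) {k : ℕ}
    (m : Fin k → ℕ) (hm : ∀ j, 0 < m j) :
    pitmanEPPF α θ m ≤ ∏ j, risingFactorial (1 - α) (m j - 1) := by
  have hW : 0 ≤ ∏ j, risingFactorial (1 - α) (m j - 1) :=
    Finset.prod_nonneg fun j _ => (risingFactorial_pos (by linarith) _).le
  refine mul_le_of_le_one_left hW (div_le_one_of_le₀ ?_ (risingFactorial_pos (by linarith) _).le)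
  calc ∏ i ∈ Finset.range (k - 1), (θ + (i + 1) * α)
      ≤ risingFactorial (θ + 1) (k - 1) := by
        refine Finset.prod_le_prod (fun i _ => by positivity) fun i _ => ?_
        have : (0 : ℝ) ≤ i := i.cast_nonneg
        nlinarith
    _ ≤ _ := by
        refine risingFactorial_mono (by linarith) (Nat.sub_le_sub_right ?_ 1)
        calc k = ∑ _j : Fin k, 1 := by simp
          _ ≤ _ := Finset.sum_le_sum fun j _ => hm j

/-- The homogeneous recursion has no bounded solution but `0`. -/
theorem eq_zero_of_risingFactorial_recursion {α : ℝ} (hα : 0 < α) (hα1 : α < 1) {N : ℕ}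
    (hN : 0 < N) {C : ℝ} {d : ℝ → ℝ}
    (hd : ∀ θ, -α < θ → d θ = risingFactorial (θ + α) N / risingFactorial (θ + 1) N * d (θ + α))
    (hC : ∀ θ, 0 ≤ θ → |d θ| ≤ C) (θ : ℝ) (hθ : -α < θ) : d θ = 0 := by
  -- One factor of the ratio is enough: (θ+α)/(θ+1) = 1 - (1-α)/(θ+1), and the others are at most 1.
  have hc : ∀ θ, -α < θ → risingFactorial (θ + α) N / risingFactorial (θ + 1) N ≤
      Real.exp (-((1 - α) / (θ + 1))) := by
    intro θ hθ
    obtain ⟨M, rfl⟩ := Nat.exists_eq_succ_of_ne_zero hN.ne'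
    have h0 : 0 < θ + 1 := by linarith
    have h1 := risingFactorial_pos (show 0 < θ + 1 + 1 by linarith) M
    calc _ ≤ (θ + α) / (θ + 1) := by
          rw [Nat.succ_eq_add_one, risingFactorial_succ', risingFactorial_succ',
            mul_div_mul_comm]
          refine mul_le_of_le_one_right (div_nonneg (by linarith) (by linarith))
            (div_le_one_of_le₀ (risingFactorial_le (by linarith) (by linarith) _) h1.le)
      _ = -((1 - α) / (θ + 1)) + 1 := by field_simp; ring
      _ ≤ _ := Real.add_one_le_exp _
  have hc0 : ∀ θ, -α < θ → 0 ≤ risingFactorial (θ + α) N / risingFactorial (θ + 1) N := fun θ hθ =>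
    div_nonneg (risingFactorial_pos (by linarith) _).le (risingFactorial_pos (by linarith) _).le
  have hshift : ∀ i : ℕ, -α < θ + i * α := fun i => by
    have : 0 ≤ (i : ℝ) * α := by positivity
    linarith
  -- Iterating L times produces harmonic sums in the exponent, because θ + Lα + 1 ≤ (θ+2)(L+1).
  have hiter : ∀ L : ℕ, |d θ| ≤
      Real.exp (-((1 - α) / (θ + 2) * ∑ i ∈ Finset.range L, 1 / ((i : ℝ) + 1))) *
        |d (θ + L * α)| := by
    intro L
    induction L with
    | zero => simp
    | succ L ih =>
      have h1 := hd _ (hshift L)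
      have h2 : |d (θ + L * α)| ≤
          Real.exp (-((1 - α) / (θ + 2) * (1 / ((L : ℝ) + 1)))) * |d (θ + (L + 1 : ℕ) * α)| := by
        rw [h1, abs_mul, abs_of_nonneg (hc0 _ (hshift L))]
        have h3 : θ + L * α + α = θ + (L + 1 : ℕ) * α := by push_cast; ring
        rw [h3]
        refine mul_le_mul_of_nonneg_right ?_ (abs_nonneg _)
        rw [← h3]
        refine (hc _ (hshift L)).trans (Real.exp_le_exp.2 (neg_le_neg ?_))
        rw [div_mul_div_comm, mul_one]
        have hL : (0 : ℝ) ≤ L := L.cast_nonneg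
        refine div_le_div_of_nonneg_left (by linarith) ?_ ?_
        · have := hshift L
          linarith
        · nlinarith
      refine ih.trans ((mul_le_mul_of_nonneg_left h2 (Real.exp_pos _).le).trans_eq ?_)
      rw [← mul_assoc, ← Real.exp_add, Finset.sum_range_succ]
      congr 2
      ring
  have hlim : Tendsto (fun L : ℕ =>
      Real.exp (-((1 - α) / (θ + 2) * ∑ i ∈ Finset.range L, 1 / ((i : ℝ) + 1))) * C)
      atTop (𝓝 0) := by
    rw [← zero_mul C]
    refine Tendsto.mul_const C (Real.tendsto_exp_neg_atTop_nhds_zero.comp ?_)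
    exact Real.tendsto_sum_range_one_div_nat_succ_atTop.const_mul_atTop
      (div_pos (by linarith) (by linarith))
  refine abs_nonpos_iff.1 (ge_of_tendsto hlim ?_)
  -- The bound `C` is available for nonnegative parameters only; one shift from θ > -α reaches them.
  filter_upwards [eventually_ge_atTop 1] with L hL
  refine (hiter L).trans (mul_le_mul_of_nonneg_left (hC _ ?_) (Real.exp_pos _).le)
  have : (1 : ℝ) ≤ L := by exact_mod_cast hL
  nlinarith

/-! ### Moments of beta laws and independence of the first stick -/

theorem Gamma_add_natCast {a : ℝ} (ha : 0 < a) (p : ℕ) :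
    Real.Gamma (a + p) = risingFactorial a p * Real.Gamma a := by
  induction p with
  | zero => simp [risingFactorial_zero]
  | succ p ih =>
    have : a + (p + 1 : ℕ) = a + p + 1 := by push_cast; ring
    rw [this, Real.Gamma_add_one (by positivity), ih, risingFactorial_succ]
    ring

theorem beta_add_natCast {a b : ℝ} (ha : 0 < a) (hb : 0 < b) (p q : ℕ) :
    beta (a + p) (b + q) = beta a b *
      (risingFactorial a p * risingFactorial b q / risingFactorial (a + b) (p + q)) := by
  have h : a + p + (b + q) = a + b + (p + q : ℕ) := by push_cast; ring
  rw [beta, beta, h, Gamma_add_natCast ha, Gamma_add_natCast hb, Gamma_add_natCast (by positivity)]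
  have h1 := (Real.Gamma_pos_of_pos (add_pos ha hb)).ne'
  have h2 := (risingFactorial_pos (add_pos ha hb) (p + q)).ne'
  field_simp

theorem lintegral_betaLaw_pow {a b : ℝ} (ha : 0 < a) (hb : 0 < b) (p q : ℕ) :
    ∫⁻ y, ENNReal.ofReal y ^ p * ENNReal.ofReal (1 - y) ^ q ∂(betaLaw a b) =
      ENNReal.ofReal
        (risingFactorial a p * risingFactorial b q / risingFactorial (a + b) (p + q)) := by
  set C := risingFactorial a p * risingFactorial b q / risingFactorial (a + b) (p + q) with hC
  have hCpos : 0 < C := div_pos (mul_pos (risingFactorial_pos ha _) (risingFactorial_pos hb _))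
    (risingFactorial_pos (by positivity) _)
  have hm : Measurable (betaPDF a b) := (measurable_betaPDFReal a b).ennreal_ofReal
  have hap : 0 < a + p := by positivity
  have hbq : 0 < b + q := by positivity
  rw [betaLaw, if_pos ⟨ha, hb⟩, betaMeasure, lintegral_withDensity_eq_lintegral_mul _ hm
    (by fun_prop)]
  have key : ∀ y, (betaPDF a b * fun y => ENNReal.ofReal y ^ p * ENNReal.ofReal (1 - y) ^ q) y =
      ENNReal.ofReal C * betaPDF (a + p) (b + q) y := by
    intro y
    rw [Pi.mul_apply, betaPDF_eq, betaPDF_eq]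
    split_ifs with hy
    · have hy1 : 0 < 1 - y := by linarith [hy.2]
      rw [← ENNReal.ofReal_pow hy.1.le, ← ENNReal.ofReal_pow hy1.le,
        ← ENNReal.ofReal_mul (by have := hy.1; positivity), ← ENNReal.ofReal_mul' (by
          have := hy.1; positivity), ← ENNReal.ofReal_mul hCpos.le]
      congr 1
      have e1 : y ^ (a + p - 1) = y ^ (a - 1) * y ^ p := by
        rw [← Real.rpow_natCast, ← Real.rpow_add hy.1]; congr 1; ring
      have e2 : (1 - y) ^ (b + q - 1) = (1 - y) ^ (b - 1) * (1 - y) ^ q := by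
        rw [← Real.rpow_natCast (1 - y), ← Real.rpow_add hy1]; congr 1; ring
      have h3 := (beta_pos ha hb).ne'
      rw [e1, e2, beta_add_natCast ha hb, ← hC]
      field_simp
    · simp
  rw [lintegral_congr key, lintegral_const_mul' _ _ ENNReal.ofReal_ne_top,
    lintegral_betaPDF_eq_one hap hbq, mul_one]

theorem ae_betaLaw_mem_Icc (a b : ℝ) : ∀ᵐ y ∂(betaLaw a b), y ∈ Icc (0 : ℝ) 1 := by
  unfold betaLaw
  split_ifs with h
  · have hm : Measurable (betaPDF a b) := (measurable_betaPDFReal a b).ennreal_ofReal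
    rw [betaMeasure, ae_withDensity_iff hm]
    refine Eventually.of_forall fun y hy => ?_
    by_contra h'
    rcases not_and_or.1 h' with h' | h'
    · exact hy (betaPDF_eq_zero_of_nonpos (not_le.1 h').le)
    · exact hy (betaPDF_eq_zero_of_one_le (not_le.1 h').le)
  · exact (ae_dirac_iff (p := fun y => y ∈ Icc (0 : ℝ) 1) measurableSet_Icc).2 (by simp)

/-- The sequence with first term `p.1` followed by the sequence `p.2`. -/
def consSequence (p : ℝ × (ℕ → ℝ)) : ℕ → ℝ
  | 0 => p.1
  | n + 1 => p.2 n

theorem measurable_consSequence : Measurable consSequence := by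
  refine measurable_pi_iff.2 fun n => ?_
  cases n with
  | zero => exact measurable_fst
  | succ n => exact (measurable_pi_apply n).comp measurable_snd

theorem map_consSequence (μ : ℕ → Measure ℝ) [∀ n, IsProbabilityMeasure (μ n)] :
    ((μ 0).prod (Measure.infinitePi fun n => μ (n + 1))).map consSequence =
      Measure.infinitePi μ := by
  refine Measure.eq_infinitePi μ fun s t ht => ?_
  classical
  -- Padding with `univ` turns the cylinder into a box over an initial segment, from which
  -- coordinate 0 splits off.
  let t' : ℕ → Set ℝ := fun i => if i ∈ s then t i else univ
  have ht' : ∀ i, MeasurableSet (t' i) := fun i => by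
    dsimp only [t']; split_ifs
    · exact ht i
    · exact MeasurableSet.univ
  obtain ⟨N, hN⟩ := s.exists_nat_subset_range
  have h1 : Set.pi s t = Set.pi (Finset.range (N + 1)) t' := by
    ext x
    simp only [Set.mem_pi, Finset.mem_coe, t']
    refine ⟨fun h i _ => ?_, fun h i hi => ?_⟩
    · split_ifs with hi
      · exact h i hi
      · trivial
    · have := h i (Finset.range_mono (Nat.le_succ N) (hN hi))
      rwa [if_pos hi] at this
  have h2 : consSequence ⁻¹' Set.pi (Finset.range (N + 1)) t' =
      t' 0 ×ˢ Set.pi (Finset.range N) (fun i => t' (i + 1)) := by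
    ext x
    simp only [Set.mem_preimage, Set.mem_pi, Finset.mem_coe, Finset.mem_range, Set.mem_prod]
    refine ⟨fun h => ⟨h 0 (by omega), fun i hi => h (i + 1) (by omega)⟩, fun h i hi => ?_⟩
    cases i with
    | zero => exact h.1
    | succ i => exact h.2 i (by omega)
  have h3 : ∏ i ∈ s, μ i (t i) = ∏ i ∈ Finset.range (N + 1), μ i (t' i) := by
    rw [← Finset.prod_subset (hN.trans (Finset.range_mono (Nat.le_succ N)))]
    · exact Finset.prod_congr rfl fun i hi => by simp [t', hi]
    · intro i _ hi
      simp [t', hi]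
  rw [h3, h1, Measure.map_apply measurable_consSequence
    (MeasurableSet.pi (Finset.countable_toSet _) fun i _ => ht' i), h2, Measure.prod_prod,
    Measure.infinitePi_pi _ fun i _ => ht' _, Finset.prod_range_succ', mul_comm]

theorem stickBreaking_consSequence_zero (p : ℝ × (ℕ → ℝ)) :
    stickBreaking (consSequence p) 0 = p.1 := by
  simp [stickBreaking, consSequence]

theorem stickBreaking_consSequence_succ (p : ℝ × (ℕ → ℝ)) (n : ℕ) :
    stickBreaking (consSequence p) (n + 1) = (1 - p.1) * stickBreaking p.2 n := by
  simp only [stickBreaking, Finset.prod_range_succ', consSequence]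
  ring

/-- Self-similarity of stick breaking: since θ + (n+2)α = (θ+α) + (n+1)α, what follows the first
stick, divided by 1 - y, is a stick breaking with parameters (α, θ+α) independent of y. -/
theorem lintegral_stickBreakingLaw (α θ : ℝ) {F : (ℕ → ℝ) → ENNReal} (hF : Measurable F) :
    ∫⁻ f, F f ∂(stickBreakingLaw α θ) =
      ∫⁻ y, ∫⁻ f, F (consSequence (y, fun n => (1 - y) * f n)) ∂(stickBreakingLaw α (θ + α))
        ∂(betaLaw (1 - α) (θ + α)) := by
  have hlaw : ∀ n : ℕ, betaLaw (1 - α) (θ + ((n + 1 : ℕ) + 1) * α) =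
      betaLaw (1 - α) (θ + α + (n + 1) * α) := fun n => by
    congr 1; push_cast; ring
  have hcons : ∀ p : ℝ × (ℕ → ℝ), stickBreaking (consSequence p) =
      consSequence (p.1, fun n => (1 - p.1) * stickBreaking p.2 n) := by
    intro p
    funext n
    cases n with
    | zero => exact stickBreaking_consSequence_zero p
    | succ n => exact stickBreaking_consSequence_succ p n
  have hm : Measurable fun p : ℝ × (ℕ → ℝ) => consSequence (p.1, fun n => (1 - p.1) * p.2 n) :=
    measurable_consSequence.comp (by fun_prop)
  rw [stickBreakingLaw, lintegral_map hF measurable_stickBreaking, ← map_consSequence,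
    lintegral_map (f := fun a => F (stickBreaking a)) (hF.comp measurable_stickBreaking)
      measurable_consSequence]
  have : (Measure.infinitePi fun n : ℕ => betaLaw (1 - α) (θ + ((n + 1 : ℕ) + 1) * α)) =
      Measure.infinitePi fun n : ℕ => betaLaw (1 - α) (θ + α + (n + 1) * α) := by
    simp_rw [hlaw]
  rw [this, lintegral_prod _ (by
    exact ((hF.comp measurable_stickBreaking).comp measurable_consSequence).aemeasurable)]
  simp only [Nat.cast_zero, zero_add, one_mul]
  refine lintegral_congr fun y => ?_
  rw [stickBreakingLaw, lintegral_map (f := fun f => F (consSequence (y, fun n => (1 - y) * f n)))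
    (hF.comp (hm.comp measurable_prodMk_left)) measurable_stickBreaking]
  refine lintegral_congr fun f => ?_
  rw [hcons]

theorem sum_stickBreaking (Y : ℕ → ℝ) (n : ℕ) :
    ∑ i ∈ Finset.range n, stickBreaking Y i = 1 - ∏ i ∈ Finset.range n, (1 - Y i) := by
  induction n with
  | zero => simp
  | succ n ih =>
    rw [Finset.sum_range_succ, ih, Finset.prod_range_succ, stickBreaking]
    ring

/-- Partial sums telescope to 1 - ∏ (1 - Y_i). That the total mass is exactly 1 is not needed yet
and follows from the sampling formula in `ae_poissonDirichlet_proper`. -/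
theorem ae_stickBreakingLaw (α θ : ℝ) : ∀ᵐ f ∂(stickBreakingLaw α θ),
    (∀ n, 0 ≤ f n) ∧ ∀ n, ∑ i ∈ Finset.range n, f i ≤ 1 := by
  have hms : MeasurableSet {f : ℕ → ℝ | (∀ n, 0 ≤ f n) ∧ ∀ n, ∑ i ∈ Finset.range n, f i ≤ 1} := by
    measurability
  rw [stickBreakingLaw, ae_map_iff measurable_stickBreaking.aemeasurable hms]
  have h : ∀ᵐ Y ∂(Measure.infinitePi fun n : ℕ => betaLaw (1 - α) (θ + (n + 1) * α)),
      ∀ n, Y n ∈ Icc (0 : ℝ) 1 := by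
    refine ae_all_iff.2 fun n => ?_
    exact (measurePreserving_eval_infinitePi
      (fun n : ℕ => betaLaw (1 - α) (θ + (n + 1) * α)) n).quasiMeasurePreserving.ae
      (ae_betaLaw_mem_Icc _ _)
  filter_upwards [h] with Y hY
  have hp : ∀ n, 0 ≤ ∏ i ∈ Finset.range n, (1 - Y i) := fun n =>
    Finset.prod_nonneg fun i _ => by linarith [(hY i).2]
  exact ⟨fun n => mul_nonneg (hp n) (hY n).1, fun n => by
    rw [sum_stickBreaking]; linarith [hp n]⟩

/-! ### Sums over distinct indices -/

/-- The sum of `∏ j, s (e j) ^ m j` over the families `e` of `k` distinct indices. -/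
noncomputable def distinctSum {k : ℕ} (m : Fin k → ℕ) (s : ℕ → ℝ) : ENNReal :=
  ∑' e : Fin k ↪ ℕ, ∏ j, ENNReal.ofReal (s (e j)) ^ m j

instance countable_finEmbedding (k : ℕ) : Countable (Fin k ↪ ℕ) :=
  DFunLike.coe_injective.countable

theorem measurable_distinctSum {k : ℕ} (m : Fin k → ℕ) : Measurable (distinctSum m) := by
  unfold distinctSum
  refine Measurable.tsum fun e => Finset.measurable_prod _ fun j _ => ?_
  exact ((measurable_pi_apply (e j)).ennreal_ofReal).pow_const _

theorem tsum_prod_fin (k : ℕ) (a : ℕ → ENNReal) :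
    ∑' e : Fin k → ℕ, ∏ j, a (e j) = (∑' i, a i) ^ k := by
  induction k with
  | zero => simp
  | succ k ih =>
    rw [← (Fin.consEquiv fun _ : Fin (k + 1) => ℕ).tsum_eq, ENNReal.tsum_prod']
    simp only [Fin.consEquiv_apply, Fin.prod_univ_succ, Fin.cons_zero, Fin.cons_succ,
      ENNReal.tsum_mul_left, ih, ENNReal.tsum_mul_right, pow_succ']

theorem distinctSum_le_one {k : ℕ} (m : Fin k → ℕ) (hm : ∀ j, 0 < m j) {s : ℕ → ℝ}
    (hs : ∀ n, 0 ≤ s n) (hs1 : ∀ n, ∑ i ∈ Finset.range n, s i ≤ 1) : distinctSum m s ≤ 1 := by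
  have h1 : ∀ i, s i ≤ 1 := fun i => by
    have := hs1 (i + 1)
    rw [Finset.sum_range_succ] at this
    linarith [Finset.sum_nonneg fun j (_ : j ∈ Finset.range i) => hs j]
  have h2 : ∑' i, ENNReal.ofReal (s i) ≤ 1 := by
    rw [ENNReal.tsum_eq_iSup_nat]
    refine iSup_le fun n => ?_
    rw [← ENNReal.ofReal_sum_of_nonneg fun i _ => hs i]
    exact ENNReal.ofReal_le_one.2 (hs1 n)
  calc distinctSum m s ≤ ∑' e : Fin k ↪ ℕ, ∏ j, ENNReal.ofReal (s (e j)) := by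
        refine ENNReal.tsum_le_tsum fun e => Finset.prod_le_prod' fun j _ => ?_
        exact pow_le_of_le_one zero_le (ENNReal.ofReal_le_one.2 (h1 _)) (hm j).ne'
    _ ≤ ∑' e : Fin k → ℕ, ∏ j, ENNReal.ofReal (s (e j)) :=
        ENNReal.tsum_comp_le_tsum_of_injective
          (f := fun e : Fin k ↪ ℕ => (e : Fin k → ℕ)) DFunLike.coe_injective
          (fun e => ∏ j, ENNReal.ofReal (s (e j)))
    _ = (∑' i, ENNReal.ofReal (s i)) ^ k := tsum_prod_fin k fun i => ENNReal.ofReal (s i)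
    _ ≤ 1 := pow_le_one' h2 k

/-- The embedding that sends `j` to `0` and the other elements to positive integers. -/
def insertZeroEmbedding {k : ℕ} (j : Fin (k + 1)) (e : Fin k ↪ ℕ) : Fin (k + 1) ↪ ℕ where
  toFun := Fin.insertNth (α := fun _ => ℕ) j 0 fun i => e i + 1
  inj' := by
    intro a b
    refine Fin.succAboveCases j ?_ (fun a => ?_) a <;>
      refine Fin.succAboveCases j ?_ (fun b => ?_) b <;> simp

theorem insertZeroEmbedding_self {k : ℕ} (j : Fin (k + 1)) (e : Fin k ↪ ℕ) :
    insertZeroEmbedding j e j = 0 :=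
  Fin.insertNth_apply_same (α := fun _ => ℕ) j 0 fun i => e i + 1

theorem insertZeroEmbedding_succAbove {k : ℕ} (j : Fin (k + 1)) (e : Fin k ↪ ℕ) (i : Fin k) :
    insertZeroEmbedding j e (j.succAbove i) = e i + 1 :=
  Fin.insertNth_apply_succAbove (α := fun _ => ℕ) j 0 (fun i => e i + 1) i

/-- An injection into ℕ either avoids 0, and is then a shifted injection, or takes the value 0 at
exactly one index j. -/
theorem tsum_finEmbedding_succ {k : ℕ} (F : (Fin (k + 1) ↪ ℕ) → ENNReal) :
    ∑' e, F e = ∑' e : Fin (k + 1) ↪ ℕ, F (e.trans (addRightEmbedding 1)) +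
      ∑ j, ∑' e : Fin k ↪ ℕ, F (insertZeroEmbedding j e) := by
  let Φ : (Fin (k + 1) ↪ ℕ) ⊕ (Fin (k + 1) × (Fin k ↪ ℕ)) → (Fin (k + 1) ↪ ℕ) :=
    Sum.elim (fun e => e.trans (addRightEmbedding 1)) fun p => insertZeroEmbedding p.1 p.2
  have hΦ : Function.Bijective Φ := by
    have hz := @insertZeroEmbedding_self k
    have hs := @insertZeroEmbedding_succAbove k
    constructor
    · rintro (e | ⟨j, e⟩) (e' | ⟨j', e'⟩) h
      · congr 1
        ext i
        simpa [Φ] using DFunLike.congr_fun h i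
      · have := DFunLike.congr_fun h j'
        simp [Φ, hz] at this
      · have := DFunLike.congr_fun h j
        simp [Φ, hz] at this
      · have h' : insertZeroEmbedding j e = insertZeroEmbedding j' e' := h
        have hj : j = j' := (insertZeroEmbedding j' e').injective (by rw [← h', hz, h', hz])
        subst hj
        have : e = e' := by
          ext i
          have := DFunLike.congr_fun h' (j.succAbove i)
          rwa [hs, hs, Nat.succ_inj] at this
        rw [this]
    · intro e
      by_cases h : ∃ j, e j = 0
      · obtain ⟨j, hj⟩ := h
        have hpos : ∀ i, e (j.succAbove i) ≠ 0 := fun i hi =>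
          Fin.succAbove_ne j i (e.injective (hi.trans hj.symm))
        refine ⟨Sum.inr (j, ⟨fun i => e (j.succAbove i) - 1, fun a b hab => ?_⟩), ?_⟩
        · have h1 := hpos a
          have h2 := hpos b
          have h3 : e (j.succAbove a) = e (j.succAbove b) := by
            dsimp only at hab
            omega
          exact Fin.succAbove_right_injective (e.injective h3)
        · ext i
          refine Fin.succAboveCases j ?_ (fun i => ?_) i
          · simp only [Φ, Sum.elim_inr, hz, hj]
          · simp only [Φ, Sum.elim_inr, hs]
            exact Nat.sub_add_cancel (Nat.pos_of_ne_zero (hpos i))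
      · push Not at h
        refine ⟨Sum.inl ⟨fun i => e i - 1, fun a b hab => ?_⟩, ?_⟩
        · have h1 := h a
          have h2 := h b
          dsimp only at hab
          exact e.injective (by omega)
        · ext i
          exact Nat.sub_add_cancel (Nat.pos_of_ne_zero (h i))
  rw [← (Equiv.ofBijective Φ hΦ).tsum_eq, Summable.tsum_sum ENNReal.summable ENNReal.summable,
    ENNReal.tsum_prod', tsum_fintype (L := SummationFilter.unconditional (Fin (k + 1)))]
  rfl

/-- Pathwise form of the recursion: the first stick is used by no block or by exactly one block j,
and every remaining power carries a factor 1 - y. -/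
theorem distinctSum_consSequence {k : ℕ} (m : Fin (k + 1) → ℕ) (y : ℝ) (hy : y ≤ 1) (f : ℕ → ℝ) :
    distinctSum m (consSequence (y, fun n => (1 - y) * f n)) =
      ENNReal.ofReal (1 - y) ^ (∑ j, m j) * distinctSum m f +
        ∑ j, ENNReal.ofReal y ^ m j * ENNReal.ofReal (1 - y) ^ (∑ i, m (j.succAbove i)) *
          distinctSum (fun i => m (j.succAbove i)) f := by
  have hs : ∀ n, ENNReal.ofReal (consSequence (y, fun n => (1 - y) * f n) (n + 1)) =
      ENNReal.ofReal (1 - y) * ENNReal.ofReal (f n) := fun n =>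
    ENNReal.ofReal_mul (sub_nonneg.2 hy)
  have h0 : consSequence (y, fun n => (1 - y) * f n) 0 = y := rfl
  rw [distinctSum, tsum_finEmbedding_succ]
  congr 1
  · rw [distinctSum, ← ENNReal.tsum_mul_left]
    refine tsum_congr fun e => ?_
    simp only [Function.Embedding.trans_apply, addRightEmbedding_apply, hs, mul_pow,
      Finset.prod_mul_distrib, Finset.prod_pow_eq_pow_sum]
  · refine Finset.sum_congr rfl fun j _ => ?_
    rw [distinctSum, ← ENNReal.tsum_mul_left]
    refine tsum_congr fun e => ?_
    rw [Fin.prod_univ_succAbove _ j]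
    simp only [insertZeroEmbedding_self, insertZeroEmbedding_succAbove, hs, h0, mul_pow, Finset.prod_mul_distrib,
      Finset.prod_pow_eq_pow_sum, mul_assoc]

theorem lintegral_distinctSum_le_one (α θ : ℝ) {k : ℕ} (m : Fin k → ℕ) (hm : ∀ j, 0 < m j) :
    ∫⁻ f, distinctSum m f ∂(stickBreakingLaw α θ) ≤ 1 := by
  calc _ ≤ ∫⁻ _, 1 ∂(stickBreakingLaw α θ) := by
        refine lintegral_mono_ae ?_
        filter_upwards [ae_stickBreakingLaw α θ] with f hf
        exact distinctSum_le_one m hm hf.1 hf.2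
    _ = 1 := by simp

theorem lintegral_distinctSum_recursion {α θ : ℝ} (hα1 : α < 1) (hθ : -α < θ) {k : ℕ}
    (m : Fin (k + 1) → ℕ) :
    ∫⁻ f, distinctSum m f ∂(stickBreakingLaw α θ) =
      ENNReal.ofReal (risingFactorial (θ + α) (∑ j, m j) / risingFactorial (θ + 1) (∑ j, m j)) *
          ∫⁻ f, distinctSum m f ∂(stickBreakingLaw α (θ + α)) +
        ∑ j, ENNReal.ofReal (risingFactorial (1 - α) (m j) *
            risingFactorial (θ + α) (∑ i, m (j.succAbove i)) / risingFactorial (θ + 1) (∑ j, m j)) *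
          ∫⁻ f, distinctSum (fun i => m (j.succAbove i)) f ∂(stickBreakingLaw α (θ + α)) := by
  have hab : 1 - α + (θ + α) = θ + 1 := by ring
  rw [lintegral_stickBreakingLaw α θ (measurable_distinctSum m)]
  -- The factor y^0 puts the first term in the shape of `lintegral_betaLaw_pow`.
  have h1 : ∀ᵐ y ∂(betaLaw (1 - α) (θ + α)),
      ∫⁻ f, distinctSum m (consSequence (y, fun n => (1 - y) * f n))
        ∂(stickBreakingLaw α (θ + α)) =
      ENNReal.ofReal y ^ 0 * ENNReal.ofReal (1 - y) ^ (∑ j, m j) *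
          ∫⁻ f, distinctSum m f ∂(stickBreakingLaw α (θ + α)) +
        ∑ j, ENNReal.ofReal y ^ m j * ENNReal.ofReal (1 - y) ^ (∑ i, m (j.succAbove i)) *
          ∫⁻ f, distinctSum (fun i => m (j.succAbove i)) f ∂(stickBreakingLaw α (θ + α)) := by
    filter_upwards [ae_betaLaw_mem_Icc (1 - α) (θ + α)] with y hy
    simp only [distinctSum_consSequence m y hy.2, pow_zero, one_mul]
    rw [lintegral_add_left ((measurable_distinctSum m).const_mul _),
      lintegral_const_mul _ (measurable_distinctSum m),
      lintegral_finsetSum _ fun j _ => (measurable_distinctSum _).const_mul _]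
    congr 1
    exact Finset.sum_congr rfl fun j _ => lintegral_const_mul _ (measurable_distinctSum _)
  rw [lintegral_congr_ae h1, lintegral_add_left (by fun_prop),
    lintegral_mul_const _ (by fun_prop), lintegral_betaLaw_pow (by linarith) (by linarith),
    lintegral_finsetSum _ fun j _ => by fun_prop, hab, risingFactorial_zero, one_mul, zero_add]
  congr 1
  refine Finset.sum_congr rfl fun j _ => ?_
  rw [lintegral_mul_const _ (by fun_prop), lintegral_betaLaw_pow (by linarith) (by linarith), hab,
    ← Fin.sum_univ_succAbove]

/-- Pitman's sampling formula for the size-biased permutation of `PD(α, θ)`. -/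
theorem lintegral_distinctSum {α θ : ℝ} (hα : 0 < α) (hα1 : α < 1) (hθ : -α < θ) {k : ℕ}
    (m : Fin k → ℕ) (hm : ∀ j, 0 < m j) :
    ∫⁻ f, distinctSum m f ∂(stickBreakingLaw α θ) = ENNReal.ofReal (pitmanEPPF α θ m) := by
  induction k generalizing θ with
  | zero => simp [distinctSum, pitmanEPPF, risingFactorial_zero]
  | succ k ih =>
    set T : ℝ → ENNReal := fun θ => ∫⁻ f, distinctSum m f ∂(stickBreakingLaw α θ) with hT
    have hT1 : ∀ θ, T θ ≤ 1 := fun θ => lintegral_distinctSum_le_one α θ m hm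
    have hTtop : ∀ θ, T θ ≠ ⊤ := fun θ => ((hT1 θ).trans_lt ENNReal.one_lt_top).ne
    have hN : 0 < ∑ j, m j := Finset.sum_pos (fun j _ => hm j) Finset.univ_nonempty
    -- The terms with one block fewer agree by the induction hypothesis at θ + α, so they drop out
    -- of the difference.
    have hrec : ∀ θ, -α < θ → (T θ).toReal - pitmanEPPF α θ m =
        risingFactorial (θ + α) (∑ j, m j) / risingFactorial (θ + 1) (∑ j, m j) *
          ((T (θ + α)).toReal - pitmanEPPF α (θ + α) m) := by
      intro θ hθ
      have h1 : T θ = _ := lintegral_distinctSum_recursion hα1 hθ m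
      have hpos : ∀ {x : ℝ} (n : ℕ), 0 < x → 0 ≤ risingFactorial x n := fun n hx =>
        (risingFactorial_pos hx n).le
      have e1 := hpos (x := θ + α)
      have e2 := hpos (x := θ + 1)
      have e3 := hpos (x := 1 - α)
      have hA : 0 ≤ risingFactorial (θ + α) (∑ j, m j) / risingFactorial (θ + 1) (∑ j, m j) :=
        div_nonneg (e1 _ (by linarith)) (e2 _ (by linarith))
      have hB : ∀ j : Fin (k + 1), 0 ≤ risingFactorial (1 - α) (m j) *
            risingFactorial (θ + α) (∑ i, m (j.succAbove i)) /
              risingFactorial (θ + 1) (∑ j, m j) := fun j =>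
        div_nonneg (mul_nonneg (e3 _ (by linarith)) (e1 _ (by linarith))) (e2 _ (by linarith))
      have hp : ∀ j : Fin (k + 1), 0 ≤ pitmanEPPF α (θ + α) (fun i => m (j.succAbove i)) := fun j =>
        pitmanEPPF_nonneg hα hα1 (by linarith) _
      have h2 : T θ = ENNReal.ofReal
          (risingFactorial (θ + α) (∑ j, m j) / risingFactorial (θ + 1) (∑ j, m j) *
            (T (θ + α)).toReal + ∑ j, risingFactorial (1 - α) (m j) *
            risingFactorial (θ + α) (∑ i, m (j.succAbove i)) / risingFactorial (θ + 1) (∑ j, m j) *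
            pitmanEPPF α (θ + α) (fun i => m (j.succAbove i))) := by
        rw [h1, ENNReal.ofReal_add (mul_nonneg hA ENNReal.toReal_nonneg)
          (Finset.sum_nonneg fun j _ => mul_nonneg (hB j) (hp j)), ENNReal.ofReal_mul hA,
          ENNReal.ofReal_toReal (hTtop _), ENNReal.ofReal_sum_of_nonneg
            (s := Finset.univ) fun j _ => mul_nonneg (hB j) (hp j)]
        congr 1
        refine Finset.sum_congr rfl fun j _ => ?_
        rw [ENNReal.ofReal_mul (hB j), ih (by linarith) _ fun i => hm _]
      rw [h2, ENNReal.toReal_ofReal (add_nonneg (mul_nonneg hA ENNReal.toReal_nonneg)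
        (Finset.sum_nonneg fun j _ => mul_nonneg (hB j) (hp j))),
        pitmanEPPF_recursion hα1 hθ m hm]
      ring
    have hbound : ∀ θ, 0 ≤ θ → |(T θ).toReal - pitmanEPPF α θ m| ≤
        1 + ∏ j, risingFactorial (1 - α) (m j - 1) := by
      intro θ hθ
      have h1 : (T θ).toReal ≤ 1 := ENNReal.toReal_le_of_le_ofReal zero_le_one (by simpa using hT1 θ)
      have h2 := pitmanEPPF_le hα hα1 hθ m hm
      have h3 := pitmanEPPF_nonneg hα hα1 (by linarith : -α < θ) m
      have h4 : 0 ≤ (T θ).toReal := ENNReal.toReal_nonneg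
      rw [abs_le]
      constructor <;> linarith
    have h0 := eq_zero_of_risingFactorial_recursion hα hα1 hN hrec hbound θ hθ
    change T θ = _
    rw [← sub_eq_zero.1 h0, ENNReal.ofReal_toReal (hTtop _)]

/-! ### Decreasing rearrangements -/

theorem finite_setOf_lt_of_sum_le_one {s : ℕ → ℝ} (hs : ∀ n, 0 ≤ s n)
    (hs1 : ∀ n, ∑ i ∈ Finset.range n, s i ≤ 1) {y : ℝ} (hy : 0 < y) : {i | y < s i}.Finite := by
  have h := (summable_of_sum_range_le hs hs1).tendsto_atTop_zero.eventually_lt_const hy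
  obtain ⟨N, hN⟩ := eventually_atTop.1 h
  refine (finite_lt_nat N).subset fun i hi => ?_
  by_contra h'
  exact lt_asymm hi (hN i (not_lt.1 h'))

/-- The supremum exceeds y exactly when some set of n + 1 indices lies inside {y < s}. The two
assumptions exclude default values: the real supremum is over a bounded family, and `ncard` counts a
finite set. -/
theorem lt_decreasingRearrangement_iff {s : ℕ → ℝ} (hs : ∀ n, s n ≤ 1) {y : ℝ}
    (hy : {i | y < s i}.Finite) (n : ℕ) :
    y < decreasingRearrangement s n ↔ n < {i | y < s i}.ncard := by
  have hne : Nonempty {A : Finset ℕ // A.card = n + 1} := ⟨⟨Finset.range (n + 1), by simp⟩⟩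
  have hbdd : BddAbove (range fun A : {A : Finset ℕ // A.card = n + 1} =>
      A.1.inf' (Finset.card_pos.1 (by have h := A.2; omega)) s) := by
    refine ⟨1, ?_⟩
    rintro _ ⟨A, rfl⟩
    obtain ⟨i, hi⟩ := Finset.card_pos.1 (show 0 < A.1.card by have h := A.2; omega)
    exact (Finset.inf'_le _ hi).trans (hs i)
  rw [decreasingRearrangement, lt_ciSup_iff hbdd]
  simp only [Finset.lt_inf'_iff]
  constructor
  · rintro ⟨A, hA⟩
    have h1 : (A.1 : Set ℕ) ⊆ {i | y < s i} := fun i hi => hA i hi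
    have h2 := ncard_le_ncard h1 hy
    rw [ncard_coe_finset, A.2] at h2
    omega
  · intro h
    rw [ncard_eq_toFinset_card _ hy] at h
    obtain ⟨A, hA, hcard⟩ := Finset.exists_subset_card_eq (Nat.succ_le_of_lt h)
    exact ⟨⟨A, hcard⟩, fun i hi => (hy.mem_toFinset.1 (hA hi) : y < s i)⟩

theorem decreasingRearrangement_nonneg {s : ℕ → ℝ} (hs : ∀ n, 0 ≤ s n) (n : ℕ) :
    0 ≤ decreasingRearrangement s n :=
  Real.iSup_nonneg fun A => by
    rw [Finset.le_inf'_iff]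
    exact fun i _ => hs i

/-- Finitely many terms exceed y/2, so for x just below y the level set at y is {x < c} minus {y <
c}. Equal superlevel counts therefore give equal level counts. -/
theorem ncard_setOf_eq_eq {a b : ℕ → ℝ} (ha : ∀ y, 0 < y → {i | y < a i}.Finite)
    (hb : ∀ y, 0 < y → {i | y < b i}.Finite)
    (hab : ∀ y, 0 < y → {i | y < a i}.ncard = {i | y < b i}.ncard) {y : ℝ} (hy : 0 < y) :
    {i | a i = y}.ncard = {i | b i = y}.ncard := by
  have hgap : ∀ c : ℕ → ℝ, (∀ y, 0 < y → {i | y < c i}.Finite) →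
      ∀ᶠ x in 𝓝[<] y, {i | c i = y} = {i | x < c i} \ {i | y < c i} := by
    intro c hc
    have hy2 : 0 < y / 2 := half_pos hy
    have h1 : ∀ᶠ x in 𝓝[<] y, ∀ i ∈ {i | y / 2 < c i}, c i < y → c i < x := by
      refine (Finite.eventually_all (hc _ hy2)).2 fun i _ => ?_
      by_cases hi : c i < y
      · filter_upwards [Ioo_mem_nhdsLT hi] with x hx _ using hx.1
      · exact Eventually.of_forall fun x h => absurd h hi
    filter_upwards [h1, Ioo_mem_nhdsLT (half_lt_self hy)] with x hx hxy
    ext i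
    simp only [mem_ofPred_eq, Set.mem_sdiff, not_lt]
    constructor
    · intro h
      exact ⟨h ▸ hxy.2, h.le⟩
    · rintro ⟨h, h'⟩
      by_contra h''
      exact lt_asymm h (hx i (hxy.1.trans h) (lt_of_le_of_ne h' h''))
  obtain ⟨x, hxa, hxb, hx⟩ := ((hgap a ha).and ((hgap b hb).and
    (Ioo_mem_nhdsLT hy : ∀ᶠ x in 𝓝[<] y, x ∈ Ioo 0 y))).exists
  have hsub : ∀ c : ℕ → ℝ, {i | y < c i} ⊆ {i | x < c i} := fun c i hi => hx.2.trans hi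
  rw [hxa, hxb, ncard_sdiff (hsub a) (ha y hy), ncard_sdiff (hsub b) (hb y hy), hab x hx.1,
    hab y hy]

/-- Bijections between the finite level sets are glued together. The value 0 is left out because
rearranging may change the number of zeros. -/
theorem exists_support_equiv {a b : ℕ → ℝ} (ha : ∀ y, 0 < y → {i | y < a i}.Finite)
    (hb : ∀ y, 0 < y → {i | y < b i}.Finite)
    (hab : ∀ y, 0 < y → {i | y < a i}.ncard = {i | y < b i}.ncard) :
    ∃ σ : {i // 0 < a i} ≃ {i // 0 < b i}, ∀ i, b (σ i) = a i := by
  have hfib : ∀ y, Nonempty ({i : {i // 0 < a i} // a i = y} ≃ {i : {i // 0 < b i} // b i = y}) := by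
    intro y
    rcases le_or_gt y 0 with hy | hy
    · have : IsEmpty {i : {i // 0 < a i} // a i = y} := ⟨fun i => by
        have := i.1.2; have := i.2; linarith⟩
      have : IsEmpty {i : {i // 0 < b i} // b i = y} := ⟨fun i => by
        have := i.1.2; have := i.2; linarith⟩
      exact ⟨Equiv.equivOfIsEmpty _ _⟩
    · have key : ∀ c : ℕ → ℝ, (∀ y, 0 < y → {i | y < c i}.Finite) → {i | c i = y}.Finite :=
        fun c hc => (hc (y / 2) (half_pos hy)).subset fun i hi => by
          have : c i = y := hi
          simp only [mem_ofPred_eq]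
          linarith
      have hcast : ∀ c : ℕ → ℝ, Nonempty ({i : {i // 0 < c i} // c i = y} ≃ {i | c i = y}) :=
        fun c => ⟨(Equiv.subtypeSubtypeEquivSubtypeInter (fun i => 0 < c i) fun i => c i = y).trans
          (Equiv.subtypeEquivRight fun i => ⟨fun h => h.2, fun h => ⟨h ▸ hy, h⟩⟩)⟩
      have := (key a ha).to_subtype
      have := (key b hb).to_subtype
      have h := ncard_setOf_eq_eq ha hb hab hy
      rw [← Nat.card_coe_set_eq, ← Nat.card_coe_set_eq] at h
      obtain ⟨ea⟩ := hcast a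
      obtain ⟨eb⟩ := hcast b
      obtain ⟨e⟩ := Finite.card_eq.1 h
      exact ⟨ea.trans (e.trans eb.symm)⟩
  let e := fun y => (hfib y).some
  refine ⟨(Equiv.sigmaFiberEquiv fun i : {i // 0 < a i} => a i).symm.trans
    ((Equiv.sigmaCongrRight e).trans (Equiv.sigmaFiberEquiv fun i : {i // 0 < b i} => b i)),
    fun i => ?_⟩
  exact (e (a i) ⟨i, rfl⟩).2

theorem distinctSum_eq_tsum_support {k : ℕ} (m : Fin k → ℕ) (hm : ∀ j, 0 < m j) (s : ℕ → ℝ) :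
    distinctSum m s =
      ∑' e : Fin k ↪ {i // 0 < s i}, ∏ j, ENNReal.ofReal (s (e j)) ^ m j := by
  have hinj : Function.Injective fun e : Fin k ↪ {i // 0 < s i} =>
      e.trans (Function.Embedding.subtype _) := by
    intro e e' h
    ext j
    exact DFunLike.congr_fun h j
  refine (hinj.tsum_eq (f := fun e : Fin k ↪ ℕ => ∏ j, ENNReal.ofReal (s (e j)) ^ m j) ?_).symm
  intro e he
  have hpos : ∀ j, 0 < s (e j) := by
    intro j
    by_contra h
    refine he (Finset.prod_eq_zero (Finset.mem_univ j) ?_)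
    rw [ENNReal.ofReal_of_nonpos (not_lt.1 h), zero_pow (hm j).ne']
  exact ⟨⟨fun j => ⟨e j, hpos j⟩, fun i j h => e.injective (congrArg Subtype.val h)⟩, rfl⟩

/-- Since all exponents are positive, only positive terms contribute, and rearranging preserves the
multiset of positive values. -/
theorem distinctSum_decreasingRearrangement {k : ℕ} (m : Fin k → ℕ) (hm : ∀ j, 0 < m j)
    {s : ℕ → ℝ} (hs : ∀ n, 0 ≤ s n) (hs1 : ∀ n, ∑ i ∈ Finset.range n, s i ≤ 1) :
    distinctSum m (decreasingRearrangement s) = distinctSum m s := by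
  have h1 : ∀ i, s i ≤ 1 := fun i => by
    have := hs1 (i + 1)
    rw [Finset.sum_range_succ] at this
    linarith [Finset.sum_nonneg fun j (_ : j ∈ Finset.range i) => hs j]
  have hfin : ∀ y, 0 < y → {i | y < s i}.Finite := fun y => finite_setOf_lt_of_sum_le_one hs hs1
  have hset : ∀ y, 0 < y →
      {i | y < decreasingRearrangement s i} = Iio {i | y < s i}.ncard := fun y hy => by
    ext i
    exact lt_decreasingRearrangement_iff h1 (hfin y hy) i
  obtain ⟨σ, hσ⟩ := exists_support_equiv (a := s) (b := decreasingRearrangement s) hfin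
    (fun y hy => by rw [hset y hy]; exact finite_Iio _) (fun y hy => by
      rw [hset y hy, ← Finset.coe_Iio, ncard_coe_finset, Nat.card_Iio])
  rw [distinctSum_eq_tsum_support m hm, distinctSum_eq_tsum_support m hm,
    ← (Equiv.embeddingCongr (Equiv.refl (Fin k)) σ).tsum_eq]
  refine tsum_congr fun e => Finset.prod_congr rfl fun j _ => ?_
  rw [← hσ]
  rfl

/-! ### The paint-box of a proper mass-partition -/

theorem eq_of_mem_paintBoxCell {s : ℕ → ℝ} (hs : ∀ n, 0 ≤ s n) {u : ℝ} {k l : ℕ}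
    (hk : k ∈ paintBoxCell s u) (hl : l ∈ paintBoxCell s u) : k = l := by
  have hmono : Monotone fun n => ∑ i ∈ Finset.range n, s i :=
    monotone_nat_of_le_succ fun n => by rw [Finset.sum_range_succ]; linarith [hs n]
  by_contra h
  rcases lt_or_gt_of_ne h with h | h
  · exact absurd (hmono (Nat.succ_le_of_lt h)) (not_le.2 (hl.1.trans_lt hk.2))
  · exact absurd (hmono (Nat.succ_le_of_lt h)) (not_le.2 (hk.1.trans_lt hl.2))

theorem paintBoxCell_nonempty {s : ℕ → ℝ} (hs1 : HasSum s 1) {u : ℝ} (hu : 0 ≤ u) (hu1 : u < 1) :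
    (paintBoxCell s u).Nonempty := by
  classical
  have h : ∃ n, u < ∑ i ∈ Finset.range n, s i :=
    (hs1.tendsto_sum_nat.eventually_const_lt hu1).exists
  have h0 : Nat.find h ≠ 0 := by
    intro h0
    have := Nat.find_spec h
    rw [h0, Finset.sum_range_zero] at this
    linarith
  obtain ⟨k, hk⟩ := Nat.exists_eq_succ_of_ne_zero h0
  refine ⟨k, not_lt.1 (Nat.find_min h (by omega)), ?_⟩
  have := Nat.find_spec h
  rwa [hk] at this

theorem volume_paintBoxCell {s : ℕ → ℝ} (hs : ∀ n, 0 ≤ s n) (hs1 : HasSum s 1) (k : ℕ) :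
    (volume : Measure unitInterval) {u | k ∈ paintBoxCell s (u : ℝ)} = ENNReal.ofReal (s k) := by
  have h0 : 0 ≤ ∑ i ∈ Finset.range k, s i := Finset.sum_nonneg fun i _ => hs i
  have h1 : ∑ i ∈ Finset.range (k + 1), s i ≤ 1 := sum_le_hasSum _ (fun i _ => hs i) hs1
  have h2 : {u : unitInterval | k ∈ paintBoxCell s (u : ℝ)} =
      Subtype.val ⁻¹' Ico (∑ i ∈ Finset.range k, s i) (∑ i ∈ Finset.range (k + 1), s i) := rfl
  have h3 : Ico (∑ i ∈ Finset.range k, s i) (∑ i ∈ Finset.range (k + 1), s i) ⊆ Icc 0 1 :=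
    fun u hu => ⟨h0.trans hu.1, hu.2.le.trans h1⟩
  rw [h2, Measure.Subtype.volume_def, comap_subtype_coe_apply measurableSet_Icc,
    Subtype.image_preimage_coe, inter_eq_right.2 h3, Real.volume_Ico, Finset.sum_range_succ]
  congr 1
  ring

/-- With total mass 1 there is no dust: each U_i lies in a unique cell c_i, and the partition is the
kernel of c. It equals the kernel of the surjection b exactly when c is b followed by an injection.
-/
theorem restrict_paintBox_eq_ker_iff {s : ℕ → ℝ} (hs : ∀ n, 0 ≤ s n) (hs1 : HasSum s 1) {n k : ℕ}
    {b : Fin n → Fin k} (hb : Function.Surjective b) {U : ℕ → ℝ} (hU : ∀ i : Fin n, 0 ≤ U i)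
    (hU1 : ∀ i : Fin n, U i < 1) :
    partitionRestrict n (paintBox s U) = Setoid.ker b ↔
      ∃ e : Fin k ↪ ℕ, ∀ i : Fin n, e (b i) ∈ paintBoxCell s (U i) := by
  choose c hc using fun i : Fin n => paintBoxCell_nonempty hs1 (hU i) (hU1 i)
  have hcell : ∀ i : Fin n, paintBoxCell s (U i) = {c i} := fun i =>
    Set.eq_singleton_iff_unique_mem.2 ⟨hc i, fun l hl => eq_of_mem_paintBoxCell hs hl (hc i)⟩
  have hrel : ∀ i j, partitionRestrict n (paintBox s U) i j ↔ c i = c j := by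
    intro i j
    have : partitionRestrict n (paintBox s U) i j ↔ ((i : ℕ) = j ∨
      ((paintBoxCell s (U i)).Nonempty ∧ paintBoxCell s (U i) = paintBoxCell s (U j))) := Iff.rfl
    rw [this, hcell, hcell, Set.singleton_eq_singleton_iff]
    constructor
    · rintro (h | h)
      · rw [Fin.ext h]
      · exact h.2
    · exact fun h => Or.inr ⟨singleton_nonempty _, h⟩
  constructor
  · intro h
    have hcb : ∀ i j, c i = c j ↔ b i = b j := fun i j => by
      rw [← hrel, h, Setoid.ker_def]
    choose r hr using hb
    refine ⟨⟨fun j => c (r j), fun i j hij => ?_⟩, fun i => ?_⟩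
    · have := (hcb _ _).1 hij
      rwa [hr, hr] at this
    · rw [hcell]
      exact (hcb _ _).2 (hr _)
  · rintro ⟨e, he⟩
    have hce : ∀ i, c i = e (b i) := fun i => by
      have := he i
      rw [hcell] at this
      exact this.symm
    refine Setoid.ext fun i j => ?_
    rw [hrel, hce, hce, e.injective.eq_iff, Setoid.ker_def]

/-- The event splits according to the injection from blocks to cells. By independence each piece has
probability ∏_i s(e(b i)), and grouping the factors by blocks produces the exponents. -/
theorem measure_restrict_paintBox_eq_ker {s : ℕ → ℝ} (hs : ∀ n, 0 ≤ s n) (hs1 : HasSum s 1)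
    {n k : ℕ} {b : Fin n → Fin k} (hb : Function.Surjective b) {m : Fin k → ℕ}
    (hm : ∀ j, (Finset.univ.filter fun i => b i = j).card = m j) :
    (Measure.infinitePi fun _ : ℕ => (volume : Measure unitInterval))
      {U | partitionRestrict n (paintBox s fun i => (U i : ℝ)) = Setoid.ker b} =
      distinctSum m s := by
  set ν := Measure.infinitePi fun _ : ℕ => (volume : Measure unitInterval) with hν
  let E : (Fin k ↪ ℕ) → Set (ℕ → unitInterval) := fun e =>
    {U | ∀ i : Fin n, e (b i) ∈ paintBoxCell s (U i : ℝ)}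
  -- The uniform variables live on the closed interval, and the endpoint 1 belongs to no cell.
  have hU1 : ∀ᵐ U ∂ν, ∀ i : Fin n, (U i : ℝ) < 1 := by
    refine ae_all_iff.2 fun i => ?_
    have h1 : ∀ᵐ u : unitInterval ∂(volume : Measure unitInterval), (u : ℝ) < 1 := by
      have h2 : ({1}ᶜ : Set unitInterval) ∈ ae (volume : Measure unitInterval) :=
        compl_mem_ae_iff.2 (measure_singleton 1)
      filter_upwards [h2] with u hu
      exact lt_of_le_of_ne u.2.2 fun h => hu (Subtype.ext h)
    exact (measurePreserving_eval_infinitePi (fun _ : ℕ => (volume : Measure unitInterval))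
      (i : ℕ)).quasiMeasurePreserving.ae h1
  have hae : {U : ℕ → unitInterval |
      partitionRestrict n (paintBox s fun i => (U i : ℝ)) = Setoid.ker b} =ᵐ[ν] ⋃ e, E e := by
    filter_upwards [hU1] with U hU
    refine propext ?_
    change partitionRestrict n (paintBox s fun i => (U i : ℝ)) = Setoid.ker b ↔ U ∈ ⋃ e, E e
    rw [restrict_paintBox_eq_ker_iff hs hs1 hb (fun i => (U i).2.1) hU, mem_iUnion]
    rfl
  have hmeas : ∀ l, MeasurableSet {u : unitInterval | l ∈ paintBoxCell s (u : ℝ)} := fun l =>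
    (measurableSet_le measurable_const measurable_subtype_coe).inter
      (measurableSet_lt measurable_subtype_coe measurable_const)
  let t : (Fin k ↪ ℕ) → ℕ → Set unitInterval := fun e i =>
    if h : i < n then {u | e (b ⟨i, h⟩) ∈ paintBoxCell s (u : ℝ)} else univ
  have ht : ∀ e i, MeasurableSet (t e i) := fun e i => by
    dsimp only [t]
    split_ifs
    · exact hmeas _
    · exact MeasurableSet.univ
  have hEt : ∀ e, E e = Set.pi (Finset.range n) (t e) := by
    intro e
    ext U
    simp only [Set.mem_pi, Finset.mem_coe, Finset.mem_range]
    constructor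
    · intro h i hi
      dsimp only [t]
      rw [dif_pos hi]
      exact h ⟨i, hi⟩
    · intro h i
      have := h i i.2
      dsimp only [t] at this
      rw [dif_pos i.2] at this
      exact this
  have hdisj : Pairwise (Function.onFun Disjoint E) := by
    intro e e' hne
    refine Set.disjoint_left.2 fun U hU hU' => hne ?_
    ext j
    obtain ⟨i, rfl⟩ := hb j
    exact eq_of_mem_paintBoxCell hs (hU i) (hU' i)
  rw [measure_congr hae, measure_iUnion hdisj fun e => by
    rw [hEt]; exact MeasurableSet.pi (Finset.countable_toSet _) fun i _ => ht e i]
  refine tsum_congr fun e => ?_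
  rw [hEt, hν, Measure.infinitePi_pi _ fun i _ => ht e i, Finset.prod_range]
  have h1 : ∀ i : Fin n, (volume : Measure unitInterval) (t e i) =
      ENNReal.ofReal (s (e (b i))) := fun i => by
    dsimp only [t]
    rw [dif_pos i.2, volume_paintBoxCell hs hs1]
  rw [Finset.prod_congr rfl fun i _ => h1 i,
    ← Finset.prod_fiberwise' Finset.univ b fun j => ENNReal.ofReal (s (e j))]
  refine Finset.prod_congr rfl fun j _ => ?_
  rw [Finset.prod_const, hm]

theorem measurableSet_restrict_eq (n : ℕ) (σ : Setoid (Fin n)) :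
    MeasurableSet {π : Setoid ℕ | partitionRestrict n π = σ} := by
  have : {π : Setoid ℕ | partitionRestrict n π = σ} =
      ⋂ i : Fin n, ⋂ j : Fin n, {π : Setoid ℕ | π i j ↔ σ i j} := by
    ext π
    simp only [mem_iInter]
    exact Setoid.ext_iff
  rw [this]
  refine MeasurableSet.iInter fun i => MeasurableSet.iInter fun j => ?_
  exact measurableSet_setOfPred.2
    ((measurableSet_setOfPred.1 (measurableSet_partition_rel (i : ℕ) (j : ℕ))).iff
      measurable_const)

theorem distinctSum_one (s : ℕ → ℝ) :
    distinctSum (fun _ : Fin 1 => 1) s = ∑' i, ENNReal.ofReal (s i) := by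
  let σ : (Fin 1 ↪ ℕ) ≃ ℕ := Equiv.ofBijective (fun e => e 0)
    ⟨fun e e' h => by ext j; rw [Subsingleton.elim j 0]; exact h,
      fun i => ⟨⟨fun _ => i, Function.injective_of_subsingleton _⟩, rfl⟩⟩
  rw [← σ.tsum_eq]
  refine tsum_congr fun e => ?_
  simp only [Finset.univ_unique, Finset.prod_singleton, pow_one]
  rfl

/-- The sampling formula for one block of size 1 says that the total mass has mean 1; being at most
1, it equals 1 almost surely. -/
theorem ae_poissonDirichlet_proper {α θ : ℝ} (hα : 0 < α) (hα1 : α < 1) (hθ : -α < θ) :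
    ∀ᵐ f ∂(stickBreakingLaw α θ), (∀ n, 0 ≤ decreasingRearrangement f n) ∧
      HasSum (decreasingRearrangement f) 1 := by
  have hone : ∀ j : Fin 1, 0 < (fun _ : Fin 1 => 1) j := fun _ => Nat.one_pos
  have hint : ∫⁻ f, distinctSum (fun _ : Fin 1 => 1) f ∂(stickBreakingLaw α θ) = 1 := by
    rw [lintegral_distinctSum hα hα1 hθ _ hone]
    simp [pitmanEPPF, risingFactorial_zero]
  have hle : distinctSum (fun _ : Fin 1 => 1) ≤ᵐ[stickBreakingLaw α θ] fun _ => 1 := by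
    filter_upwards [ae_stickBreakingLaw α θ] with f hf
    exact distinctSum_le_one _ hone hf.1 hf.2
  have heq := ae_eq_of_ae_le_of_lintegral_le hle (by rw [hint]; exact ENNReal.one_ne_top)
    aemeasurable_const (by rw [hint]; simp)
  filter_upwards [ae_stickBreakingLaw α θ, heq] with f hf hf1
  have h0 := decreasingRearrangement_nonneg hf.1
  rw [← distinctSum_decreasingRearrangement _ hone hf.1 hf.2, distinctSum_one] at hf1
  refine ⟨h0, ?_⟩
  have hsum := ENNReal.hasSum_toReal (f := fun i => ENNReal.ofReal (decreasingRearrangement f i))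
    (by rw [hf1]; exact ENNReal.one_ne_top)
  have h2 : ∀ i, (ENNReal.ofReal (decreasingRearrangement f i)).toReal =
    decreasingRearrangement f i := fun i => ENNReal.toReal_ofReal (h0 i)
  simp only [h2] at hsum
  have h3 := ENNReal.tsum_toReal_eq (f := fun i => ENNReal.ofReal (decreasingRearrangement f i))
    fun i => ENNReal.ofReal_ne_top
  simp only [h2] at h3
  rw [← h3, hf1, ENNReal.toReal_one] at hsum
  exact hsum

/-- Pitman's sampling formula for the paint-box partition of `PD(α, θ)`. -/
theorem paintBoxLaw_poissonDirichlet_ker {α θ : ℝ} (hα : 0 < α) (hα1 : α < 1) (hθ : -α < θ)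
    {n k : ℕ} {b : Fin n → Fin k} (hb : Function.Surjective b) {m : Fin k → ℕ}
    (hm : ∀ j, (Finset.univ.filter fun i => b i = j).card = m j) :
    paintBoxLaw (poissonDirichlet α θ) {π | partitionRestrict n π = Setoid.ker b} =
      ENNReal.ofReal (pitmanEPPF α θ m) := by
  have hpos : ∀ j, 0 < m j := fun j => by
    obtain ⟨i, hi⟩ := hb j
    rw [← hm j]
    exact Finset.card_pos.2 ⟨i, by simp [hi]⟩
  have hS := measurableSet_restrict_eq n (Setoid.ker b)
  rw [paintBoxLaw, Measure.map_apply measurable_paintBox hS,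
    Measure.prod_apply (measurable_paintBox hS), poissonDirichlet,
    lintegral_map (measurable_measure_prodMk_left (measurable_paintBox hS))
      measurable_decreasingRearrangement, ← lintegral_distinctSum hα hα1 hθ m hpos]
  refine lintegral_congr_ae ?_
  filter_upwards [ae_stickBreakingLaw α θ, ae_poissonDirichlet_proper hα hα1 hθ] with f hf hf'
  rw [← distinctSum_decreasingRearrangement m hpos hf.1 hf.2,
    ← measure_restrict_paintBox_eq_ker hf'.1 hf'.2 hb hm]
  rfl

theorem eppf_poissonDirichlet {α θ : ℝ} (hα : 0 < α) (hα1 : α < 1) (hθ : -α < θ) {k : ℕ}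
    (m : Fin k → ℕ) (hm : ∀ j, 0 < m j) :
    eppf (paintBoxLaw (poissonDirichlet α θ)) m = pitmanEPPF α θ m := by
  have hb : Function.Surjective fun x => (finSigmaFinEquiv (n := m).symm x).1 := fun j =>
    ⟨finSigmaFinEquiv ⟨j, ⟨0, hm j⟩⟩, by simp⟩
  have hcard : ∀ j, (Finset.univ.filter
      fun x => (finSigmaFinEquiv (n := m).symm x).1 = j).card = m j := by
    intro j
    rw [← Fintype.card_subtype, Fintype.card_congr ((finSigmaFinEquiv (n := m).symm.subtypeEquiv
      (q := fun y : (i : Fin k) × Fin (m i) => y.1 = j) fun x => Iff.rfl).trans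
      (Equiv.sigmaSubtype j)), Fintype.card_fin]
  rw [eppf, Measure.real]
  have := paintBoxLaw_poissonDirichlet_ker hα hα1 hθ hb hcard
  rw [show {π | partitionRestrict (∑ i, m i) π = consecutivePartition m} =
    {π | partitionRestrict (∑ i, m i) π = Setoid.ker
      fun x => (finSigmaFinEquiv (n := m).symm x).1} from rfl, this,
    ENNReal.toReal_ofReal (pitmanEPPF_nonneg hα hα1 hθ m)]

/-! ### Transitions of the fragmentation -/

theorem measurable_frag (π : Setoid ℕ) : Measurable (frag π) := by
  refine measurable_partition fun i j => ?_
  have h : MeasurableSet {p : ℕ → Setoid ℕ | p (blockIndex π i) i j} :=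
    measurable_pi_apply (X := fun _ : ℕ => Setoid ℕ) (blockIndex π i)
      (measurableSet_partition_rel i j)
  exact (MeasurableSet.const (π i j)).inter h

/-- All of [n] lies in the block of 0, whose label is 0, so no other partition of the sequence is
seen. -/
theorem restrict_frag_eq_of_eq_top {n : ℕ} {π : Setoid ℕ} (hπ : partitionRestrict n π = ⊤)
    (p : ℕ → Setoid ℕ) : partitionRestrict n (frag π p) = partitionRestrict n (p 0) := by
  have hrel : ∀ i j : Fin n, π i j := fun i j => by
    have : partitionRestrict n π i j := by rw [hπ]; trivial
    exact this
  refine Setoid.ext fun i j => ?_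
  have hidx : blockIndex π i = 0 := by
    have hn : 0 < n := i.pos
    have h0 : blockMin π i = 0 := Nat.eq_zero_of_le_zero (Nat.sInf_le (hrel i ⟨0, hn⟩))
    simp [blockIndex, h0]
  change (π i j ∧ p (blockIndex π i) i j) ↔ p 0 i j
  rw [hidx]
  exact and_iff_right (hrel i j)

theorem restrict_frag_ne_top {n : ℕ} {π : Setoid ℕ} (hπ : partitionRestrict n π ≠ ⊤)
    (p : ℕ → Setoid ℕ) : partitionRestrict n (frag π p) ≠ ⊤ := by
  contrapose! hπ
  refine Setoid.ext fun i j => ?_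
  have h : partitionRestrict n (frag π p) i j := by rw [hπ]; trivial
  exact ⟨fun _ => trivial, fun _ => h.1⟩

theorem fragLaw_restrict_eq {ρ : Measure (Setoid ℕ)} [IsProbabilityMeasure ρ] {n : ℕ}
    {π : Setoid ℕ} (hπ : partitionRestrict n π = ⊤) (σ : Setoid (Fin n)) :
    fragLaw ρ π {π' | partitionRestrict n π' = σ} = ρ {π' | partitionRestrict n π' = σ} := by
  have hS := measurableSet_restrict_eq n σ
  rw [fragLaw, Measure.map_apply (measurable_frag π) hS,
    ← (measurePreserving_eval_infinitePi (fun _ : ℕ => ρ) 0).measure_preimage hS.nullMeasurableSet]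
  congr 1
  ext p
  change partitionRestrict n (frag π p) = σ ↔ partitionRestrict n (p 0) = σ
  rw [restrict_frag_eq_of_eq_top hπ]

theorem fragLaw_restrict_eq_top {ρ : Measure (Setoid ℕ)} [IsProbabilityMeasure ρ] {n : ℕ}
    {π : Setoid ℕ} (hπ : partitionRestrict n π ≠ ⊤) :
    fragLaw ρ π {π' | partitionRestrict n π' = ⊤} = 0 := by
  rw [fragLaw, Measure.map_apply (measurable_frag π) (measurableSet_restrict_eq n ⊤)]
  have h : frag π ⁻¹' {π' | partitionRestrict n π' = ⊤} = ∅ :=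
    eq_empty_of_forall_notMem fun p hp => restrict_frag_ne_top hπ p hp
  rw [h, measure_empty]

namespace IsRuelleFragmentation

variable {Ω : Type*} [MeasurableSpace Ω] {P : Measure Ω} {X : ℝ → Ω → Setoid ℕ}

/-- Integrated Markov property: {X u ∈ D} belongs to the past at time u, and the conditional
probability is the constant c on it. -/
theorem measureReal_inter [IsProbabilityMeasure P] (hX : IsRuelleFragmentation P X) {u v : ℝ}
    (hu : 0 ≤ u) (huv : u < v) (hv : v < 1) {D A : Set (Setoid ℕ)} (hD : MeasurableSet D)
    (hA : MeasurableSet A) {c : ℝ}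
    (hc : ∀ π ∈ D, (fragLaw (paintBoxLaw (poissonDirichlet v (-u))) π).real A = c) :
    P.real (X u ⁻¹' D ∩ X v ⁻¹' A) = P.real (X u ⁻¹' D) * c := by
  obtain ⟨s, rfl⟩ : ∃ s, v = u + s := ⟨v - u, by ring⟩
  have hm : pastSigmaAlgebra X u ≤ ‹MeasurableSpace Ω› :=
    iSup₂_le fun w hw => measurable_iff_comap_le.1 (hX.measurable w ⟨hw.1, by linarith [hw.2]⟩)
  have hD' : MeasurableSet[pastSigmaAlgebra X u] (X u ⁻¹' D) :=
    le_iSup₂_of_le (f := fun (w : ℝ) (_ : w ∈ Icc 0 u) =>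
      MeasurableSpace.comap (X w) partitionMeasurableSpace) u ⟨hu, le_refl u⟩ le_rfl _
      ⟨D, hD, rfl⟩
  have hA' : MeasurableSet (X (u + s) ⁻¹' A) := hX.measurable _ ⟨by linarith, hv⟩ hA
  have h1 := setIntegral_condExp hm (μ := P) (f := (X (u + s) ⁻¹' A).indicator fun _ => (1 : ℝ))
    ((integrable_const _).indicator hA') hD'
  have h2 := hX.markov u s hu (by linarith) hv A hA
  rw [setIntegral_congr_ae (g := fun _ => c) (hm _ hD') (by
    filter_upwards [h2] with ω hω hωD
    rw [hω]
    exact hc _ hωD), setIntegral_const, integral_indicator_const _ hA', smul_eq_mul, smul_eq_mul,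
    mul_one, measureReal_restrict_apply hA'] at h1
  rw [inter_comm, h1]

theorem measureReal_restrict_eq_ker [IsProbabilityMeasure P] (hX : IsRuelleFragmentation P X)
    {u v : ℝ} (hu : 0 ≤ u) (huv : u < v) (hv : v < 1) {n k : ℕ} {b : Fin n → Fin k}
    (hb : Function.Surjective b) {m : Fin k → ℕ}
    (hm : ∀ j, (Finset.univ.filter fun i => b i = j).card = m j) :
    P.real ({ω | partitionRestrict n (X u ω) = ⊤} ∩
      {ω | partitionRestrict n (X v ω) = Setoid.ker b}) =
      P.real {ω | partitionRestrict n (X u ω) = ⊤} * pitmanEPPF v (-u) m := by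
  refine hX.measureReal_inter hu huv hv (measurableSet_restrict_eq n ⊤)
    (measurableSet_restrict_eq n (Setoid.ker b)) fun π hπ => ?_
  rw [Measure.real, fragLaw_restrict_eq hπ,
    paintBoxLaw_poissonDirichlet_ker (hu.trans_lt huv) hv (by linarith) hb hm,
    ENNReal.toReal_ofReal (pitmanEPPF_nonneg (hu.trans_lt huv) hv (by linarith) m)]

theorem measureReal_restrict_eq_top [IsProbabilityMeasure P] (hX : IsRuelleFragmentation P X)
    {n : ℕ} (hn : 0 < n) {t : ℝ} (ht : t ∈ Ico (0 : ℝ) 1) :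
    P.real {ω | partitionRestrict n (X t ω) = ⊤} =
      risingFactorial (1 - t) (n - 1) / risingFactorial 1 (n - 1) := by
  have h0 : ∀ᵐ ω ∂P, partitionRestrict n (X 0 ω) = ⊤ := by
    filter_upwards [hX.standard] with ω hω
    rw [hω]
    exact Setoid.ext fun i j => ⟨fun _ => trivial, fun _ => trivial⟩
  have h0' : P.real {ω | partitionRestrict n (X 0 ω) = ⊤} = 1 := by
    rw [measureReal_congr (t := univ) (eventuallyEq_univ.2 h0), probReal_univ]
  -- The Markov property needs a positive time step, so t = 0 is separate; for t > 0 the one-block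
  -- formula is applied from time 0.
  rcases ht.1.eq_or_lt with rfl | ht0
  · rw [h0', sub_zero, div_self (risingFactorial_pos one_pos _).ne']
  · have hb : Function.Surjective fun _ : Fin n => (0 : Fin 1) := fun j =>
      ⟨⟨0, hn⟩, Subsingleton.elim _ _⟩
    have h1 := hX.measureReal_restrict_eq_ker le_rfl ht0 ht.2 hb (m := fun _ => n) fun j => by
      simp [Subsingleton.elim (0 : Fin 1) j]
    have hker : Setoid.ker (fun _ : Fin n => (0 : Fin 1)) = ⊤ :=
      Setoid.ext fun i j => ⟨fun _ => trivial, fun _ => rfl⟩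
    rw [h0', one_mul, hker] at h1
    have h2 : P.real ({ω | partitionRestrict n (X 0 ω) = ⊤} ∩
        {ω | partitionRestrict n (X t ω) = ⊤}) = P.real {ω | partitionRestrict n (X t ω) = ⊤} := by
      refine measureReal_congr ?_
      filter_upwards [h0] with ω hω
      exact propext ⟨fun h => h.2, fun h => ⟨hω, h⟩⟩
    rw [← h2, h1]
    simp [pitmanEPPF, div_eq_inv_mul]

theorem ae_restrict_ne_top_mono [IsProbabilityMeasure P] (hX : IsRuelleFragmentation P X)
    (n : ℕ) {u v : ℝ} (hu : 0 ≤ u) (huv : u < v) (hv : v < 1) :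
    ∀ᵐ ω ∂P, partitionRestrict n (X u ω) ≠ ⊤ → partitionRestrict n (X v ω) ≠ ⊤ := by
  have h := hX.measureReal_inter hu huv hv (measurableSet_restrict_eq n ⊤).compl
    (measurableSet_restrict_eq n ⊤) (c := 0) fun π hπ => by
      rw [Measure.real, fragLaw_restrict_eq_top hπ, ENNReal.toReal_zero]
  rw [mul_zero, measureReal_eq_zero_iff] at h
  rw [ae_iff]
  refine measure_mono_null (fun ω hω => ?_) h
  have hω' : ¬ (partitionRestrict n (X u ω) ≠ ⊤ → partitionRestrict n (X v ω) ≠ ⊤) := hω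
  push Not at hω'
  exact hω'

end IsRuelleFragmentation

/-! ### The first jump time -/

theorem firstJumpTime_mem_Icc {Ω : Type*} (X : ℝ → Ω → Setoid ℕ) (n : ℕ) (ω : Ω) :
    firstJumpTime X n ω ∈ Icc (0 : ℝ) 1 := by
  have hb : ∀ t ∈ insert 1 {t | t ∈ Ico (0 : ℝ) 1 ∧ partitionRestrict n (X t ω) ≠ ⊤}, 0 ≤ t := by
    rintro t (rfl | ht)
    · exact zero_le_one
    · exact ht.1.1
  exact ⟨Real.sInf_nonneg hb, csInf_le ⟨0, hb⟩ (mem_insert _ _)⟩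

theorem firstJumpTime_le {Ω : Type*} (X : ℝ → Ω → Setoid ℕ) {n : ℕ} {ω : Ω} {t : ℝ}
    (ht : t ∈ Ico (0 : ℝ) 1) (h : partitionRestrict n (X t ω) ≠ ⊤) : firstJumpTime X n ω ≤ t := by
  refine csInf_le ⟨0, ?_⟩ (mem_insert_of_mem _ ⟨ht, h⟩)
  rintro t (rfl | ht)
  · exact zero_le_one
  · exact ht.1.1

namespace IsRuelleFragmentation

variable {Ω : Type*} [MeasurableSpace Ω] {P : Measure Ω} {X : ℝ → Ω → Setoid ℕ}

/-- For each fixed pair of times, a nontrivial restriction stays nontrivial almost surely. Rational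
pairs give one null set, and right-continuity passes to all real times. Right-continuity also makes
the inequality strict: a restriction trivial at t stays trivial for a while. -/
theorem ae_lt_firstJumpTime_iff [IsProbabilityMeasure P] (hX : IsRuelleFragmentation P X) (n : ℕ) :
    ∀ᵐ ω ∂P, ∀ t ∈ Ico (0 : ℝ) 1,
      (t < firstJumpTime X n ω ↔ partitionRestrict n (X t ω) = ⊤) := by
  have h1 : ∀ᵐ ω ∂P, ∀ q r : ℚ, (0 : ℝ) ≤ q → (q : ℝ) < r → (r : ℝ) < 1 →
      partitionRestrict n (X q ω) ≠ ⊤ → partitionRestrict n (X r ω) ≠ ⊤ := by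
    refine ae_all_iff.2 fun q => ae_all_iff.2 fun r => ?_
    by_cases h : (0 : ℝ) ≤ q ∧ (q : ℝ) < r ∧ (r : ℝ) < 1
    · filter_upwards [hX.ae_restrict_ne_top_mono n h.1 h.2.1 h.2.2] with ω hω _ _ _ using hω
    · exact Eventually.of_forall fun ω h1 h2 h3 => absurd ⟨h1, h2, h3⟩ h
  filter_upwards [h1, hX.right_continuous] with ω hmono hrc
  have hrat : ∀ t ∈ Ico (0 : ℝ) 1, ∀ w, t < w → ∃ q : ℚ, t < q ∧ (q : ℝ) < w ∧
      partitionRestrict n (X q ω) = partitionRestrict n (X t ω) := by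
    intro t ht w hw
    obtain ⟨ε, hε, h⟩ := mem_nhdsGT_iff_exists_Ioo_subset.1 (hrc n t ht)
    obtain ⟨q, hq, hq'⟩ := exists_rat_btwn (lt_min hw hε)
    exact ⟨q, hq, hq'.trans_le (min_le_left _ _), h ⟨hq, hq'.trans_le (min_le_right _ _)⟩⟩
  have hmono' : ∀ u v : ℝ, 0 ≤ u → u < v → v < 1 →
      partitionRestrict n (X u ω) ≠ ⊤ → partitionRestrict n (X v ω) ≠ ⊤ := by
    intro u v hu huv hv h
    obtain ⟨q, hq, hqv, hqu⟩ := hrat u ⟨hu, huv.trans hv⟩ v huv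
    obtain ⟨r, hr, hr1, hrv⟩ := hrat v ⟨hu.trans huv.le, hv⟩ 1 hv
    rw [← hrv]
    rw [← hqu] at h
    exact hmono q r (hu.trans hq.le) (hqv.trans hr) hr1 h
  intro t ht
  constructor
  · intro h
    by_contra h'
    exact absurd (firstJumpTime_le X ht h') (not_le.2 h)
  · intro h
    obtain ⟨ε, hε, hsub⟩ := mem_nhdsGT_iff_exists_Ioo_subset.1 (hrc n t ht)
    have hle : min 1 ε ≤ firstJumpTime X n ω := by
      refine le_csInf ⟨1, mem_insert _ _⟩ ?_
      rintro w (rfl | ⟨hw, hw'⟩)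
      · exact min_le_left _ _
      · refine (min_le_right _ _).trans ?_
        by_contra hwε
        rcases lt_trichotomy w t with hwt | rfl | hwt
        · exact hmono' w t hw.1 hwt ht.2 hw' h
        · exact hw' h
        · exact hw' ((hsub ⟨hwt, not_le.1 hwε⟩).trans h)
    exact (lt_min ht.2 hε).trans_le hle

/-- The defining infimum is uncountable, but almost surely rational times suffice, since past the
first jump every restriction is nontrivial. -/
theorem aemeasurable_firstJumpTime [IsProbabilityMeasure P] (hX : IsRuelleFragmentation P X)
    (n : ℕ) : AEMeasurable (firstJumpTime X n) P := by
  classical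
  let I := {q : ℚ // (q : ℝ) ∈ Ico (0 : ℝ) 1}
  have : Nonempty I := ⟨⟨0, by simp⟩⟩
  let f : I → Ω → ℝ := fun q ω => if partitionRestrict n (X (q : ℚ) ω) = ⊤ then 1 else (q : ℚ)
  refine ⟨fun ω => ⨅ q, f q ω, Measurable.iInf fun q => ?_, ?_⟩
  · exact Measurable.ite (hX.measurable _ q.2 (measurableSet_restrict_eq n ⊤)) measurable_const
      measurable_const
  · filter_upwards [hX.ae_lt_firstJumpTime_iff n] with ω hω
    have hbdd : BddBelow (range fun q => f q ω) := by
      refine ⟨0, ?_⟩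
      rintro _ ⟨q, rfl⟩
      dsimp only [f]
      split_ifs
      · exact zero_le_one
      · exact q.2.1
    refine le_antisymm (le_ciInf fun q => ?_) ?_
    · dsimp only [f]
      split_ifs with h
      · exact (firstJumpTime_mem_Icc X n ω).2
      · exact firstJumpTime_le X q.2 h
    · by_contra h
      have hle1 : ⨅ q, f q ω ≤ 1 := (ciInf_le hbdd (Classical.arbitrary I)).trans (by
        dsimp only [f]
        split_ifs
        · exact le_rfl
        · exact (Classical.arbitrary I).2.2.le)
      obtain ⟨q, hq, hq'⟩ := exists_rat_btwn (not_le.1 h)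
      have hqI : (q : ℝ) ∈ Ico (0 : ℝ) 1 :=
        ⟨(firstJumpTime_mem_Icc X n ω).1.trans hq.le, hq'.trans_le hle1⟩
      have hne : partitionRestrict n (X q ω) ≠ ⊤ := fun hne =>
        lt_asymm hq ((hω q hqI).2 hne)
      have := ciInf_le hbdd ⟨q, hqI⟩
      dsimp only [f] at this
      rw [if_neg hne] at this
      exact absurd this (not_le.2 hq')

end IsRuelleFragmentation

/-! ### The state at the first jump time -/

/-- The subdivision of `[a, b]` into `M + 1` intervals of the same length. -/
noncomputable def meshPoint (a b : ℝ) (M j : ℕ) : ℝ := a + j * ((b - a) / (M + 1))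

theorem meshPoint_succ_sub (a b : ℝ) (M j : ℕ) :
    meshPoint a b M (j + 1) - meshPoint a b M j = (b - a) / (M + 1) := by
  unfold meshPoint; push_cast; ring

theorem meshPoint_zero (a b : ℝ) (M : ℕ) : meshPoint a b M 0 = a := by simp [meshPoint]

theorem meshPoint_last (a b : ℝ) (M : ℕ) : meshPoint a b M (M + 1) = b := by
  unfold meshPoint
  have : (M : ℝ) + 1 ≠ 0 := by positivity
  push_cast
  field_simp
  ring

theorem meshPoint_strictMono {a b : ℝ} (hab : a < b) (M : ℕ) : StrictMono (meshPoint a b M) := by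
  refine strictMono_nat_of_lt_succ fun j => ?_
  have := meshPoint_succ_sub a b M j
  have : 0 < (b - a) / (M + 1) := div_pos (sub_pos.2 hab) (by positivity)
  linarith

theorem meshPoint_mem_Icc {a b : ℝ} (hab : a < b) {M j : ℕ} (hj : j ≤ M + 1) :
    meshPoint a b M j ∈ Icc a b := by
  have h := (meshPoint_strictMono hab M).monotone
  exact ⟨(meshPoint_zero a b M).symm.trans_le (h (Nat.zero_le j)),
    (h hj).trans_eq (meshPoint_last a b M)⟩

theorem exists_meshPoint_lt_le {a b t : ℝ} (ht : t ∈ Ioc a b) (M : ℕ) :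
    ∃ j ≤ M, meshPoint a b M j < t ∧ t ≤ meshPoint a b M (j + 1) := by
  classical
  have h : ∃ j, t ≤ meshPoint a b M j := ⟨M + 1, by rw [meshPoint_last]; exact ht.2⟩
  have h0 : Nat.find h ≠ 0 := by
    intro h0
    have := Nat.find_spec h
    rw [h0, meshPoint_zero] at this
    exact absurd ht.1 (not_lt.2 this)
  obtain ⟨j, hj⟩ := Nat.exists_eq_succ_of_ne_zero h0
  have hle : Nat.find h ≤ M + 1 := Nat.find_min' h (by rw [meshPoint_last]; exact ht.2)
  refine ⟨j, by omega, not_le.1 (Nat.find_min h (by omega)), ?_⟩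
  have := Nat.find_spec h
  rwa [hj] at this

namespace IsRuelleFragmentation

variable {Ω : Type*} [MeasurableSpace Ω] {P : Measure Ω} {X : ℝ → Ω → Setoid ℕ}

/-- On a fine mesh, the right end of the cell containing τ is so close to τ that the state there is
still the state at τ. Earlier cells end in the trivial state, which is not σ, and later ones start
in a nontrivial state. -/
theorem ae_eventually_mesh_iff [IsProbabilityMeasure P] (hX : IsRuelleFragmentation P X) {n : ℕ}
    {σ : Setoid (Fin n)} (hσ : σ ≠ ⊤) {a b : ℝ} (ha : 0 ≤ a) (hab : a < b) (hb : b < 1) :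
    ∀ᵐ ω ∂P, ∀ᶠ M : ℕ in atTop,
      (ω ∈ ⋃ j ∈ Finset.range (M + 1),
        ({ω | partitionRestrict n (X (meshPoint a b M j) ω) = ⊤} ∩
          {ω | partitionRestrict n (X (meshPoint a b M (j + 1)) ω) = σ}) ↔
      ω ∈ {ω | firstJumpTime X n ω ∈ Ioc a b ∧
        partitionRestrict n (X (firstJumpTime X n ω) ω) = σ}) := by
  filter_upwards [hX.ae_lt_firstJumpTime_iff n, hX.right_continuous] with ω hω hrc
  set τ := firstJumpTime X n ω with hτ
  have hmem : ∀ {M j : ℕ}, j ≤ M + 1 → meshPoint a b M j ∈ Ico (0 : ℝ) 1 := fun hj =>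
    ⟨ha.trans (meshPoint_mem_Icc hab hj).1, (meshPoint_mem_Icc hab hj).2.trans_lt hb⟩
  by_cases hτab : τ ∈ Ioc a b
  · obtain ⟨ε, hε, hsub⟩ := mem_nhdsGT_iff_exists_Ioo_subset.1
      (hrc n τ ⟨ha.trans hτab.1.le, hτab.2.trans_lt hb⟩)
    have hlim : Tendsto (fun M : ℕ => (b - a) / ((M : ℝ) + 1)) atTop (𝓝 0) :=
      tendsto_const_nhds.div_atTop (tendsto_natCast_atTop_atTop.atTop_add tendsto_const_nhds)
    filter_upwards [hlim.eventually_lt_const (sub_pos.2 hε)] with M hM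
    obtain ⟨j, hjM, hj, hj'⟩ := exists_meshPoint_lt_le hτab M
    have heq : partitionRestrict n (X (meshPoint a b M (j + 1)) ω) =
        partitionRestrict n (X τ ω) := by
      rcases hj'.eq_or_lt with h | h
      · rw [h]
      · refine hsub ⟨h, ?_⟩
        have := meshPoint_succ_sub a b M j
        linarith
    simp only [mem_iUnion, Finset.mem_range]
    constructor
    · rintro ⟨i, hi, h1, h2⟩
      have h1' := (hω _ (hmem (by omega))).2 h1
      have hij : i = j := by
        by_contra hne
        rcases lt_or_gt_of_ne hne with hlt | hgt
        · refine hσ (h2.symm.trans ((hω _ (hmem (by omega))).1 ?_))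
          exact ((meshPoint_strictMono hab M).monotone (Nat.succ_le_of_lt hlt)).trans_lt hj
        · exact absurd h1' (not_lt.2 (hj'.trans
            ((meshPoint_strictMono hab M).monotone (Nat.succ_le_of_lt hgt))))
      subst hij
      exact ⟨hτab, heq.symm.trans h2⟩
    · rintro ⟨_, h⟩
      exact ⟨j, by omega, (hω _ (hmem (by omega))).1 hj, heq.trans h⟩
  · refine Eventually.of_forall fun M => ?_
    refine iff_of_false ?_ fun h => hτab h.1
    simp only [mem_iUnion, Finset.mem_range]
    rintro ⟨i, hi, h1, h2⟩
    have h1' := (hω _ (hmem (by omega))).2 h1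
    refine hσ (h2.symm.trans ((hω _ (hmem (by omega))).1 ?_))
    have haτ : a < τ := (meshPoint_mem_Icc hab (by omega)).1.trans_lt h1'
    have hbτ : b < τ := by
      by_contra h
      exact hτab ⟨haτ, not_lt.1 h⟩
    exact (meshPoint_mem_Icc hab (by omega)).2.trans_lt hbτ

theorem tendsto_sum_mesh [IsProbabilityMeasure P] (hX : IsRuelleFragmentation P X) {n : ℕ}
    {σ : Setoid (Fin n)} (hσ : σ ≠ ⊤) {a b : ℝ} (ha : 0 ≤ a) (hab : a < b) (hb : b < 1) :
    Tendsto (fun M : ℕ => ∑ j ∈ Finset.range (M + 1),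
        P.real ({ω | partitionRestrict n (X (meshPoint a b M j) ω) = ⊤} ∩
          {ω | partitionRestrict n (X (meshPoint a b M (j + 1)) ω) = σ})) atTop
      (𝓝 (P.real {ω | firstJumpTime X n ω ∈ Ioc a b ∧
        partitionRestrict n (X (firstJumpTime X n ω) ω) = σ})) := by
  have hmem : ∀ {M j : ℕ}, j ≤ M + 1 → meshPoint a b M j ∈ Ico (0 : ℝ) 1 := fun hj =>
    ⟨ha.trans (meshPoint_mem_Icc hab hj).1, (meshPoint_mem_Icc hab hj).2.trans_lt hb⟩
  set E : ℕ → ℕ → Set Ω := fun M j =>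
    {ω | partitionRestrict n (X (meshPoint a b M j) ω) = ⊤} ∩
      {ω | partitionRestrict n (X (meshPoint a b M (j + 1)) ω) = σ} with hE
  set B := {ω | firstJumpTime X n ω ∈ Ioc a b ∧
        partitionRestrict n (X (firstJumpTime X n ω) ω) = σ} with hB
  have hEm : ∀ M, ∀ j ∈ Finset.range (M + 1), MeasurableSet (E M j) := fun M j hj => by
    have := Finset.mem_range.1 hj
    exact (hX.measurable _ (hmem (by omega)) (measurableSet_restrict_eq n _)).inter
      (hX.measurable _ (hmem (by omega)) (measurableSet_restrict_eq n _))
  have hUm : ∀ M : ℕ, MeasurableSet (⋃ j ∈ Finset.range (M + 1), E M j) := fun M =>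
    Finset.measurableSet_biUnion _ (hEm M)
  have hlim := hX.ae_eventually_mesh_iff hσ ha hab hb
  have hBn : NullMeasurableSet B P :=
    nullMeasurableSet_of_tendsto_indicator atTop (fun M => (hUm M).nullMeasurableSet) hlim
  -- `B` is only null measurable, as an almost sure limit of measurable events, so its measurable
  -- hull takes its place.
  have htend := tendsto_measure_of_ae_tendsto_indicator_of_isFiniteMeasure atTop
    (measurableSet_toMeasurable P B) hUm (by
      filter_upwards [hlim, hBn.toMeasurable_ae_eq.mem_iff] with ω hω hω'
      filter_upwards [hω] with M hM
      exact hM.trans hω'.symm)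
  rw [measure_toMeasurable] at htend
  have htend' := (ENNReal.tendsto_toReal (measure_ne_top P B)).comp htend
  refine htend'.congr fun M => ?_
  have hdisj : Set.Pairwise (Finset.range (M + 1) : Set ℕ) (Function.onFun (AEDisjoint P) (E M)) := by
    have key : ∀ i j, i < j → j ∈ Finset.range (M + 1) → AEDisjoint P (E M i) (E M j) := by
      intro i j hij hj
      have := Finset.mem_range.1 hj
      refine measure_mono_null (t := {ω | ¬ ∀ t ∈ Ico (0 : ℝ) 1,
        (t < firstJumpTime X n ω ↔ partitionRestrict n (X t ω) = ⊤)}) ?_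
        (ae_iff.1 (hX.ae_lt_firstJumpTime_iff n))
      rintro ω ⟨⟨_, h1⟩, ⟨h2, _⟩⟩ hω
      have h3 := (hω _ (hmem (by omega))).2 h2
      exact hσ (h1.symm.trans ((hω _ (hmem (by omega))).1
        (((meshPoint_strictMono hab M).monotone (Nat.succ_le_of_lt hij)).trans_lt h3)))
    intro i hi j hj hne
    rcases lt_or_gt_of_ne hne with h | h
    · exact key i j h hj
    · exact (key j i h hi).symm
  rw [Function.comp_apply, measure_biUnion_finset₀ hdisj fun j hj => (hEm M j hj).nullMeasurableSet,
    ENNReal.toReal_sum fun j _ => measure_ne_top _ _]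
  rfl

/-- Bounds on the law of the first jump obtained from bounds on the transition probabilities. -/
theorem measureReal_firstJump_mem_Icc [IsProbabilityMeasure P] (hX : IsRuelleFragmentation P X)
    {n : ℕ} {σ : Setoid (Fin n)} (hσ : σ ≠ ⊤) {a b : ℝ} (ha : 0 ≤ a) (hab : a < b) (hb : b < 1)
    {c C : ℝ} (h : ∀ u v, a ≤ u → u < v → v ≤ b →
      P.real ({ω | partitionRestrict n (X u ω) = ⊤} ∩ {ω | partitionRestrict n (X v ω) = σ}) ∈
        Icc (c * (v - u)) (C * (v - u))) :
    P.real {ω | firstJumpTime X n ω ∈ Ioc a b ∧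
      partitionRestrict n (X (firstJumpTime X n ω) ω) = σ} ∈ Icc (c * (b - a)) (C * (b - a)) := by
  have hsum : ∀ (M : ℕ) (x : ℝ), x * (b - a) = ∑ j ∈ Finset.range (M + 1),
      x * (meshPoint a b M (j + 1) - meshPoint a b M j) := fun M x => by
    rw [← Finset.mul_sum, Finset.sum_range_sub, meshPoint_last, meshPoint_zero]
  have key : ∀ M, ∀ j ∈ Finset.range (M + 1), _ := fun M j hj =>
    h (meshPoint a b M j) (meshPoint a b M (j + 1))
      (meshPoint_mem_Icc hab (by have := Finset.mem_range.1 hj; omega)).1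
      (meshPoint_strictMono hab M (Nat.lt_succ_self j))
      (meshPoint_mem_Icc hab (by have := Finset.mem_range.1 hj; omega)).2
  refine isClosed_Icc.mem_of_tendsto (hX.tendsto_sum_mesh hσ ha hab hb)
    (Eventually.of_forall fun M => ⟨?_, ?_⟩)
  · rw [hsum M c]
    exact Finset.sum_le_sum fun j hj => (key M j hj).1
  · rw [hsum M C]
    exact Finset.sum_le_sum fun j hj => (key M j hj).2

end IsRuelleFragmentation

/-! ### Densities from distribution functions -/

/-- Continuity and a right derivative suffice for the fundamental theorem of calculus, so both
measures agree on the intervals (0, t]. As ψ is controlled on [0, 1) only, they are identified on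
(0, 1 - 1/(m+1)] for each m and then glued; the point 0 is null for both. -/
theorem measure_eq_setLIntegral_of_hasDerivWithinAt {Q : Measure ℝ} [IsFiniteMeasure Q]
    {F ψ : ℝ → ℝ} (hψ : ContinuousOn ψ (Ico 0 1)) (hψ0 : ∀ t ∈ Ico (0 : ℝ) 1, 0 ≤ ψ t)
    (hF : ∀ t ∈ Ico (0 : ℝ) 1, Q (Ioc 0 t) = ENNReal.ofReal (F t)) (hF0 : F 0 = 0)
    (hcont : ContinuousOn F (Ico 0 1))
    (hderiv : ∀ t ∈ Ioo (0 : ℝ) 1, HasDerivWithinAt F (ψ t) (Ioi t) t) (hQ0 : Q {0} = 0)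
    {A : Set ℝ} (hA : A ⊆ Ico 0 1) (hAm : MeasurableSet A) :
    Q A = ∫⁻ t in A, ENNReal.ofReal (ψ t) := by
  set ν := (volume : Measure ℝ).withDensity fun t => ENNReal.ofReal (ψ t) with hν
  have hint : ∀ t ∈ Ico (0 : ℝ) 1, Q (Ioc 0 t) = ν (Ioc 0 t) := by
    intro t ht
    have hsub : Icc 0 t ⊆ Ico (0 : ℝ) 1 := fun x hx => ⟨hx.1, hx.2.trans_lt ht.2⟩
    have h1 : IntervalIntegrable ψ volume 0 t :=
      (hψ.mono (by rwa [uIcc_of_le ht.1])).intervalIntegrable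
    have h2 : ∫ x in (0 : ℝ)..t, ψ x = F t - F 0 := by
      refine intervalIntegral.integral_eq_sub_of_hasDeriv_right ?_ ?_ h1
      · exact hcont.mono (by rwa [uIcc_of_le ht.1])
      · rw [min_eq_left ht.1, max_eq_right ht.1]
        exact fun x hx => hderiv x ⟨hx.1, hx.2.trans ht.2⟩
    rw [hF t ht, hν, withDensity_apply _ measurableSet_Ioc,
      ← ofReal_integral_eq_lintegral_ofReal ((intervalIntegrable_iff_integrableOn_Ioc_of_le ht.1).1 h1)
        (ae_restrict_of_forall_mem measurableSet_Ioc fun x hx =>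
          hψ0 x (hsub (Ioc_subset_Icc_self hx))),
      ← intervalIntegral.integral_of_le ht.1, h2, hF0, sub_zero]
  have hres : ∀ m : ℕ, Q.restrict (Ioc 0 (1 - 1 / ((m : ℝ) + 1))) =
      ν.restrict (Ioc 0 (1 - 1 / ((m : ℝ) + 1))) := by
    intro m
    have hc1 : 1 - 1 / ((m : ℝ) + 1) < 1 := sub_lt_self _ (by positivity)
    refine Measure.ext_of_Iic _ _ fun x => ?_
    rw [Measure.restrict_apply measurableSet_Iic, Measure.restrict_apply measurableSet_Iic,
      inter_comm, Ioc_inter_Iic]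
    rcases le_or_gt 0 (min (1 - 1 / ((m : ℝ) + 1)) x) with h | h
    · exact hint _ ⟨h, (min_le_left _ _).trans_lt hc1⟩
    · rw [Ioc_eq_empty (not_lt.2 h.le), measure_empty, measure_empty]
  have hres' := Measure.restrict_iUnion_congr.2 hres
  have hU : (⋃ m : ℕ, Ioc (0 : ℝ) (1 - 1 / ((m : ℝ) + 1))) = Ioo 0 1 := by
    ext x
    simp only [mem_iUnion]
    constructor
    · rintro ⟨m, hm⟩
      exact ⟨hm.1, hm.2.trans_lt (sub_lt_self _ (by positivity))⟩
    · intro hx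
      obtain ⟨m, hm⟩ := exists_nat_one_div_lt (sub_pos.2 hx.2)
      exact ⟨m, hx.1, by linarith⟩
  rw [hU] at hres'
  have hν0 : ν {0} = 0 := withDensity_absolutelyContinuous _ _ (measure_singleton 0)
  have hsplit : ∀ μ : Measure ℝ, μ {0} = 0 → μ A = μ (A ∩ Ioo 0 1) := by
    intro μ hμ
    refine le_antisymm ?_ (measure_mono inter_subset_left)
    have hsub : A ⊆ (A ∩ Ioo 0 1) ∪ {0} := fun x hx => by
      rcases (hA hx).1.eq_or_lt with h | h
      · exact Or.inr h.symm
      · exact Or.inl ⟨hx, h, (hA hx).2⟩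
    calc μ A ≤ μ ((A ∩ Ioo 0 1) ∪ {0}) := measure_mono hsub
      _ ≤ μ (A ∩ Ioo 0 1) + μ {0} := measure_union_le _ _
      _ = _ := by rw [hμ, add_zero]
  rw [← withDensity_apply _ hAm, ← hν, hsplit Q hQ0, hsplit ν hν0,
    ← Measure.restrict_apply hAm, hres', Measure.restrict_apply hAm]

/-! ### Survival function and transition rates -/

/-- The probability `P(τₙ > t)`. -/
noncomputable def survival (n : ℕ) (t : ℝ) : ℝ :=
  risingFactorial (1 - t) (n - 1) / risingFactorial 1 (n - 1)

/-- The density of the first jump time `τₙ`. -/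
noncomputable def survivalRate (n : ℕ) (t : ℝ) : ℝ :=
  (∑ i ∈ Finset.range (n - 1), ∏ j ∈ (Finset.range (n - 1)).erase i, (1 - t + j)) /
    risingFactorial 1 (n - 1)

theorem survival_zero (n : ℕ) : survival n 0 = 1 := by
  rw [survival, sub_zero, div_self (risingFactorial_pos one_pos _).ne']

theorem survival_one {n : ℕ} (hn : 2 ≤ n) : survival n 1 = 0 := by
  obtain ⟨N, hN⟩ : ∃ N, n - 1 = N + 1 := ⟨n - 2, by omega⟩
  rw [survival, hN, risingFactorial_succ', sub_self, zero_mul, zero_div]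

theorem survival_pos (n : ℕ) {t : ℝ} (ht : t < 1) : 0 < survival n t :=
  div_pos (risingFactorial_pos (sub_pos.2 ht) _) (risingFactorial_pos one_pos _)

theorem hasDerivAt_survival (n : ℕ) (t : ℝ) : HasDerivAt (survival n) (-survivalRate n t) t := by
  have h : ∀ i ∈ Finset.range (n - 1), HasDerivAt (fun t : ℝ => 1 - t + (i : ℝ)) (-1) t := fun i _ =>
    ((hasDerivAt_id t).const_sub 1).add_const _
  have h' := (HasDerivAt.fun_finsetProd h).div_const (risingFactorial 1 (n - 1))
  refine h'.congr_deriv ?_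
  rw [survivalRate, ← neg_div, ← Finset.sum_neg_distrib]
  congr 1
  exact Finset.sum_congr rfl fun i _ => by simp

theorem continuous_survival (n : ℕ) : Continuous (survival n) :=
  continuous_iff_continuousAt.2 fun t => (hasDerivAt_survival n t).continuousAt

theorem continuous_survivalRate (n : ℕ) : Continuous (survivalRate n) := by
  unfold survivalRate
  fun_prop

theorem survivalRate_pos {n : ℕ} (hn : 2 ≤ n) {t : ℝ} (ht : t < 1) : 0 < survivalRate n t := by
  refine div_pos (Finset.sum_pos (fun i _ => Finset.prod_pos fun j _ => ?_) ?_)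
    (risingFactorial_pos one_pos _)
  · have : (0 : ℝ) ≤ j := j.cast_nonneg
    linarith
  · exact Finset.nonempty_range_iff.2 (by omega)

/-- The kernel `ψ` such that `P(Π(u) restricted to [n] is trivial, Π(v) restricted to [n] is π)`
is `(v - u) ψ(u, v)`, for a partition `π` of `[n]` with blocks of sizes `m`. -/
noncomputable def jumpKernel {k : ℕ} (m : Fin k → ℕ) (u v : ℝ) : ℝ :=
  (∏ i ∈ Finset.range (k - 2), ((i + 2) * v - u)) * (∏ j, risingFactorial (1 - v) (m j - 1)) /
    risingFactorial 1 (∑ j, m j - 1)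

theorem continuous_jumpKernel {k : ℕ} (m : Fin k → ℕ) :
    Continuous fun p : ℝ × ℝ => jumpKernel m p.1 p.2 := by
  unfold jumpKernel risingFactorial
  fun_prop

theorem jumpKernel_self_nonneg {k : ℕ} (m : Fin k → ℕ) {t : ℝ} (ht : t ∈ Ico (0 : ℝ) 1) :
    0 ≤ jumpKernel m t t := by
  refine div_nonneg (mul_nonneg (Finset.prod_nonneg fun i _ => ?_) (Finset.prod_nonneg fun j _ =>
    (risingFactorial_pos (sub_pos.2 ht.2) _).le)) (risingFactorial_pos one_pos _).le
  have : (0 : ℝ) ≤ i * t := mul_nonneg i.cast_nonneg ht.1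
  linarith [ht.1]

/-- At θ = -u the denominator (1-u)_{n-1} is the numerator of the survival function, and the first
factor of the product is v - u. No singularity remains as v approaches u. -/
theorem survival_mul_pitmanEPPF {k : ℕ} (hk : 2 ≤ k) (m : Fin k → ℕ) {u v : ℝ} (hu : u < 1) :
    survival (∑ j, m j) u * pitmanEPPF v (-u) m = (v - u) * jumpKernel m u v := by
  obtain ⟨K, rfl⟩ : ∃ K, k = K + 2 := ⟨k - 2, by omega⟩
  have h1 := (risingFactorial_pos (sub_pos.2 hu) (∑ j, m j - 1)).ne'
  have h2 := (risingFactorial_pos one_pos (∑ j, m j - 1)).ne'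
  have h3 : -u + 1 = 1 - u := by ring
  have h4 : ∏ i ∈ Finset.range (K + 2 - 1), (-u + ((i : ℝ) + 1) * v) =
      (∏ i ∈ Finset.range (K + 2 - 2), (((i : ℝ) + 2) * v - u)) * (v - u) := by
    rw [show K + 2 - 1 = K + 1 by omega, show K + 2 - 2 = K by omega, Finset.prod_range_succ']
    congr 1
    · exact Finset.prod_congr rfl fun i _ => by push_cast; ring
    · push_cast; ring
  rw [survival, pitmanEPPF, jumpKernel, h3, h4]
  generalize ∏ i ∈ Finset.range (K + 2 - 2), (((i : ℝ) + 2) * v - u) = Q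
  field_simp

/-- On the diagonal the kernel contains t · 2t ⋯ (k-2)t; the formula at θ = 0 has the additional
factor (k-1)t. -/
theorem pitmanEPPF_zero_eq {k : ℕ} (hk : 2 ≤ k) (m : Fin k → ℕ) (t : ℝ) :
    pitmanEPPF t 0 m = t * ((k : ℝ) - 1) * jumpKernel m t t := by
  obtain ⟨K, rfl⟩ : ∃ K, k = K + 2 := ⟨k - 2, by omega⟩
  have h4 : ∏ i ∈ Finset.range (K + 2 - 1), ((0 : ℝ) + ((i : ℝ) + 1) * t) =
      (∏ i ∈ Finset.range (K + 2 - 2), (((i : ℝ) + 2) * t - t)) * ((K + 1) * t) := by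
    rw [show K + 2 - 1 = K + 1 by omega, show K + 2 - 2 = K by omega, Finset.prod_range_succ,
      zero_add]
    congr 1
    exact Finset.prod_congr rfl fun i _ => by ring
  rw [pitmanEPPF, jumpKernel, h4, zero_add]
  push_cast
  ring

theorem pitmanEPPF_zero_singleton (n : ℕ) (t : ℝ) : pitmanEPPF t 0 ![n] = survival n t := by
  simp [pitmanEPPF, survival, div_eq_inv_mul]

/-! ### Law of the first jump time, alone and jointly with the state reached -/

namespace IsRuelleFragmentation

variable {Ω : Type*} [MeasurableSpace Ω] {P : Measure Ω} [IsProbabilityMeasure P]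
  {X : ℝ → Ω → Setoid ℕ}

theorem measureReal_lt_firstJumpTime (hX : IsRuelleFragmentation P X) {n : ℕ} (hn : 0 < n) {t : ℝ}
    (ht : t ∈ Ico (0 : ℝ) 1) : P.real {ω | t < firstJumpTime X n ω} = survival n t := by
  rw [survival, ← hX.measureReal_restrict_eq_top hn ht]
  refine measureReal_congr ?_
  filter_upwards [hX.ae_lt_firstJumpTime_iff n] with ω hω
  exact propext (hω t ht)

/-- For n ≥ 2 the survival polynomial has the factor 1 - t, so it tends to 0 at time 1. -/
theorem ae_firstJumpTime_lt_one (hX : IsRuelleFragmentation P X) {n : ℕ} (hn : 2 ≤ n) :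
    ∀ᵐ ω ∂P, firstJumpTime X n ω < 1 := by
  have h : P.real {ω | 1 ≤ firstJumpTime X n ω} ≤ survival n 1 := by
    refine ge_of_tendsto ((continuous_survival n).continuousAt.tendsto.mono_left
      (nhdsWithin_le_nhds (s := Iio 1))) ?_
    filter_upwards [Ioo_mem_nhdsLT (zero_lt_one (α := ℝ))] with t ht
    rw [← hX.measureReal_lt_firstJumpTime (by omega) ⟨ht.1.le, ht.2⟩]
    exact measureReal_mono fun ω hω => ht.2.trans_le hω
  rw [survival_one hn] at h
  have h' := (measureReal_eq_zero_iff).1 (le_antisymm h measureReal_nonneg)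
  rw [ae_iff]
  simpa only [not_lt] using h'

theorem map_firstJumpTime_Ioc (hX : IsRuelleFragmentation P X) {n : ℕ} (hn : 0 < n) {a b : ℝ}
    (ha : 0 ≤ a) (hab : a ≤ b) (hb : b < 1) :
    (P.map (firstJumpTime X n)).real (Ioc a b) = survival n a - survival n b := by
  have hτ := hX.aemeasurable_firstJumpTime n
  have hQ : ∀ t ∈ Ico (0 : ℝ) 1, (P.map (firstJumpTime X n)).real (Ioi t) = survival n t :=
    fun t ht => by
      rw [map_measureReal_apply_of_aemeasurable hτ measurableSet_Ioi,
        ← hX.measureReal_lt_firstJumpTime hn ht]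
      rfl
  have : IsProbabilityMeasure (P.map (firstJumpTime X n)) := Measure.isProbabilityMeasure_map hτ
  rw [← hQ a ⟨ha, hab.trans_lt hb⟩, ← hQ b ⟨ha.trans hab, hb⟩, ← Ioc_union_Ioi_eq_Ioi hab,
    measureReal_union (Ioc_disjoint_Ioi le_rfl) measurableSet_Ioi, add_sub_cancel_right]

theorem map_firstJumpTime_zero (hX : IsRuelleFragmentation P X) {n : ℕ} (hn : 0 < n) :
    P.map (firstJumpTime X n) {0} = 0 := by
  have hτ := hX.aemeasurable_firstJumpTime n
  have h := hX.measureReal_lt_firstJumpTime hn (t := 0) ⟨le_rfl, zero_lt_one⟩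
  rw [survival_zero] at h
  have : IsProbabilityMeasure (P.map (firstJumpTime X n)) := Measure.isProbabilityMeasure_map hτ
  have h1 : (P.map (firstJumpTime X n)).real (Ioi 0) = 1 := by
    rw [map_measureReal_apply_of_aemeasurable hτ measurableSet_Ioi, ← h]
    rfl
  have h2 := measureReal_compl (μ := P.map (firstJumpTime X n)) (measurableSet_Ioi (a := (0 : ℝ)))
  rw [h1, probReal_univ, sub_self, measureReal_eq_zero_iff] at h2
  exact measure_mono_null (fun x hx => by rw [hx]; simp) h2

theorem map_firstJumpTime_eq (hX : IsRuelleFragmentation P X) {n : ℕ} (hn : 2 ≤ n) {A : Set ℝ}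
    (hA : A ⊆ Ico 0 1) (hAm : MeasurableSet A) :
    P.map (firstJumpTime X n) A = ∫⁻ t in A, ENNReal.ofReal (survivalRate n t) := by
  have : IsProbabilityMeasure (P.map (firstJumpTime X n)) :=
    Measure.isProbabilityMeasure_map (hX.aemeasurable_firstJumpTime n)
  refine measure_eq_setLIntegral_of_hasDerivWithinAt (F := fun t => 1 - survival n t)
    (continuous_survivalRate n).continuousOn (fun t ht => (survivalRate_pos hn ht.2).le)
    (fun t ht => ?_) (by simp [survival_zero])
    (continuous_const.sub (continuous_survival n)).continuousOn (fun t _ => ?_)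
    (hX.map_firstJumpTime_zero (by omega)) hA hAm
  · rw [← survival_zero n, ← hX.map_firstJumpTime_Ioc (by omega) le_rfl ht.1 ht.2,
      ofReal_measureReal]
  · simpa using ((hasDerivAt_survival n t).const_sub 1).hasDerivWithinAt

theorem measure_firstJumpTime_eq (hX : IsRuelleFragmentation P X) {n : ℕ} (hn : 2 ≤ n) {t : ℝ}
    (ht : t ∈ Ico (0 : ℝ) 1) : P {ω | firstJumpTime X n ω = t} = 0 := by
  have h := hX.map_firstJumpTime_eq hn (singleton_subset_iff.2 ht) (measurableSet_singleton t)
  rw [Measure.map_apply_of_aemeasurable (hX.aemeasurable_firstJumpTime n)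
    (measurableSet_singleton t), Measure.restrict_eq_zero.2 (measure_singleton t),
    lintegral_zero_measure] at h
  exact h

theorem measureReal_le_firstJumpTime (hX : IsRuelleFragmentation P X) {n : ℕ} (hn : 2 ≤ n) {t : ℝ}
    (ht : t ∈ Ico (0 : ℝ) 1) : P.real {ω | t ≤ firstJumpTime X n ω} = survival n t := by
  rw [← hX.measureReal_lt_firstJumpTime (by omega) ht]
  refine measureReal_congr ?_
  filter_upwards [measure_eq_zero_iff_ae_notMem.1 (hX.measure_firstJumpTime_eq hn ht)] with ω hω
  exact propext ⟨fun h => lt_of_le_of_ne h fun h' => hω h'.symm, fun h => le_of_lt h⟩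

/-- The law of the first jump time restricted to the event that the process jumps to `σ`. -/
noncomputable def jumpMeasure (P : Measure Ω) (X : ℝ → Ω → Setoid ℕ) {n : ℕ} (σ : Setoid (Fin n)) :
    Measure ℝ :=
  (P.restrict {ω | partitionRestrict n (X (firstJumpTime X n ω) ω) = σ}).map (firstJumpTime X n)

instance isFiniteMeasure_jumpMeasure (P : Measure Ω) [IsProbabilityMeasure P]
    (X : ℝ → Ω → Setoid ℕ) {n : ℕ} (σ : Setoid (Fin n)) : IsFiniteMeasure (jumpMeasure P X σ) := by
  unfold jumpMeasure
  infer_instance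

/-- Measurability of the event that the jump leads to σ is not needed: a measure restricted to an
arbitrary set can be evaluated on null measurable sets. -/
theorem jumpMeasure_apply (hX : IsRuelleFragmentation P X) {n : ℕ} (σ : Setoid (Fin n))
    {A : Set ℝ} (hA : MeasurableSet A) :
    jumpMeasure P X σ A = P {ω | firstJumpTime X n ω ∈ A ∧
      partitionRestrict n (X (firstJumpTime X n ω) ω) = σ} := by
  have hτ := hX.aemeasurable_firstJumpTime n
  rw [jumpMeasure, Measure.map_apply_of_aemeasurable hτ.restrict hA, Measure.restrict_apply₀
    (hτ.restrict.nullMeasurableSet_preimage hA)]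
  rfl

theorem jumpMeasure_le (hX : IsRuelleFragmentation P X) {n : ℕ} (σ : Setoid (Fin n))
    {A : Set ℝ} (hA : MeasurableSet A) :
    jumpMeasure P X σ A ≤ P.map (firstJumpTime X n) A := by
  rw [hX.jumpMeasure_apply σ hA,
    Measure.map_apply_of_aemeasurable (hX.aemeasurable_firstJumpTime n) hA]
  exact measure_mono fun ω hω => hω.1

theorem jumpMeasure_Ioc_le (hX : IsRuelleFragmentation P X) {n : ℕ} (hn : 0 < n)
    (σ : Setoid (Fin n)) {a b : ℝ} (ha : 0 ≤ a) (hab : a ≤ b) (hb : b < 1) :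
    (jumpMeasure P X σ).real (Ioc a b) ≤ survival n a - survival n b := by
  rw [← hX.map_firstJumpTime_Ioc hn ha hab hb]
  have : IsProbabilityMeasure (P.map (firstJumpTime X n)) :=
    Measure.isProbabilityMeasure_map (hX.aemeasurable_firstJumpTime n)
  exact ENNReal.toReal_mono (measure_ne_top _ _) (hX.jumpMeasure_le σ measurableSet_Ioc)

theorem jumpMeasure_Ioc_sub (X : ℝ → Ω → Setoid ℕ) {n : ℕ} (σ : Setoid (Fin n)) {a b : ℝ}
    (ha : 0 ≤ a) (hab : a ≤ b) :
    (jumpMeasure P X σ).real (Ioc 0 b) - (jumpMeasure P X σ).real (Ioc 0 a) =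
      (jumpMeasure P X σ).real (Ioc a b) := by
  rw [← Ioc_union_Ioc_eq_Ioc ha hab, measureReal_union (Ioc_disjoint_Ioc_of_le le_rfl)
    measurableSet_Ioc, add_sub_cancel_left]

/-- Increments are dominated by those of the survival function. -/
theorem continuousOn_jumpMeasure_Ioc (hX : IsRuelleFragmentation P X) {n : ℕ} (hn : 0 < n)
    (σ : Setoid (Fin n)) :
    ContinuousOn (fun t => (jumpMeasure P X σ).real (Ioc 0 t)) (Ico 0 1) := by
  have key : ∀ a b : ℝ, 0 ≤ a → a ≤ b → b < 1 →
      dist ((jumpMeasure P X σ).real (Ioc 0 b)) ((jumpMeasure P X σ).real (Ioc 0 a)) ≤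
        dist (survival n b) (survival n a) := by
    intro a b ha hab hb
    have h := hX.jumpMeasure_Ioc_le hn σ ha hab hb
    have h0 : 0 ≤ (jumpMeasure P X σ).real (Ioc a b) := measureReal_nonneg
    rw [Real.dist_eq, jumpMeasure_Ioc_sub X σ ha hab, abs_of_nonneg h0, dist_comm, Real.dist_eq]
    exact h.trans (le_abs_self _)
  intro t ht
  refine tendsto_iff_dist_tendsto_zero.2 (squeeze_zero' (Eventually.of_forall fun _ => dist_nonneg)
    ?_ (tendsto_iff_dist_tendsto_zero.1 (continuous_survival n).continuousWithinAt))
  filter_upwards [self_mem_nhdsWithin] with x hx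
  rcases le_total t x with h | h
  · exact key t x ht.1 h hx.2
  · rw [dist_comm, dist_comm (survival n x)]
    exact key x t hx.1 h ht.2

section Kernel

variable {n k : ℕ} {b : Fin n → Fin k} {m : Fin k → ℕ}

theorem sum_card_fiber (hm : ∀ j, (Finset.univ.filter fun i => b i = j).card = m j) :
    ∑ j, m j = n := by
  have h := Finset.card_eq_sum_card_fiberwise (s := (Finset.univ : Finset (Fin n)))
    (t := Finset.univ) (f := b) fun _ _ => Finset.mem_coe.2 (Finset.mem_univ _)
  rw [Finset.card_fin] at h
  rw [h]
  exact Finset.sum_congr rfl fun j _ => (hm j).symm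

/-- Just to the right of t the kernel stays within ε/2 of its value at (t, t). The mesh bounds turn
this into the same bounds on the difference quotient. -/
theorem hasDerivWithinAt_jumpMeasure_Ioc (hX : IsRuelleFragmentation P X)
    (hb : Function.Surjective b) (hm : ∀ j, (Finset.univ.filter fun i => b i = j).card = m j)
    (hk : 2 ≤ k) {t : ℝ} (ht : t ∈ Ico (0 : ℝ) 1) :
    HasDerivWithinAt (fun t => (jumpMeasure P X (Setoid.ker b)).real (Ioc 0 t))
      (jumpKernel m t t) (Ioi t) t := by
  have hn : 0 < n := (hb ⟨0, by omega⟩).choose.pos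
  have hker : Setoid.ker b ≠ ⊤ := by
    intro h
    obtain ⟨i, hi⟩ := hb ⟨0, by omega⟩
    obtain ⟨j, hj⟩ := hb ⟨1, by omega⟩
    have hij : Setoid.ker b i j := by rw [h]; trivial
    rw [Setoid.ker_def, hi, hj] at hij
    simp at hij
  rw [hasDerivWithinAt_iff_tendsto_slope' self_notMem_Ioi, Metric.tendsto_nhds]
  intro ε hε
  obtain ⟨δ, hδ, hδε⟩ := Metric.continuousAt_iff.1
    ((continuous_jumpKernel m).continuousAt (x := (t, t))) (ε / 2) (half_pos hε)
  filter_upwards [Ioo_mem_nhdsGT (lt_min (lt_add_of_pos_right t hδ) ht.2)] with y hy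
  have hy1 : y < 1 := hy.2.trans_le (min_le_right _ _)
  have hyδ : y < t + δ := hy.2.trans_le (min_le_left _ _)
  have hty : 0 < y - t := sub_pos.2 hy.1
  have h := hX.measureReal_firstJump_mem_Icc hker ht.1 hy.1 hy1
    (c := jumpKernel m t t - ε / 2) (C := jumpKernel m t t + ε / 2) fun u v hu huv hv => by
      have hv1 : v < 1 := hv.trans_lt hy1
      have hu0 : 0 ≤ u := ht.1.trans hu
      rw [hX.measureReal_restrict_eq_ker hu0 huv hv1 hb hm,
        hX.measureReal_restrict_eq_top hn ⟨hu0, huv.trans hv1⟩]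
      have h1 := survival_mul_pitmanEPPF hk m (v := v) (huv.trans hv1)
      rw [sum_card_fiber hm, survival] at h1
      rw [h1, mul_comm (v - u)]
      have h2 : dist (u, v) (t, t) < δ := by
        rw [Prod.dist_eq, Real.dist_eq, Real.dist_eq, max_lt_iff, abs_lt, abs_lt]
        refine ⟨⟨?_, ?_⟩, ⟨?_, ?_⟩⟩ <;> dsimp only <;> linarith
      have h3 := hδε h2
      rw [Real.dist_eq, abs_lt] at h3
      have h4 : 0 ≤ v - u := (sub_pos.2 huv).le
      exact ⟨mul_le_mul_of_nonneg_right (by linarith) h4,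
        mul_le_mul_of_nonneg_right (by linarith) h4⟩
  have hJ : (jumpMeasure P X (Setoid.ker b)).real (Ioc t y) = P.real {ω |
      firstJumpTime X n ω ∈ Ioc t y ∧
        partitionRestrict n (X (firstJumpTime X n ω) ω) = Setoid.ker b} := by
    rw [Measure.real, hX.jumpMeasure_apply _ measurableSet_Ioc]
    rfl
  rw [slope_def_field, jumpMeasure_Ioc_sub X _ ht.1 hy.1.le, hJ, Real.dist_eq]
  refine lt_of_le_of_lt ?_ (half_lt_self hε)
  rw [abs_le, neg_le_sub_iff_le_add, sub_le_iff_le_add, ← sub_le_iff_le_add, le_div_iff₀ hty,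
    div_le_iff₀ hty, add_comm (ε / 2)]
  exact h

/-- Jumping to a given state is a particular way of jumping, and right derivatives preserve the
comparison. The inequality thus holds at every t, which makes the chosen conditional probability at
most 1 everywhere. -/
theorem jumpKernel_le_survivalRate (hX : IsRuelleFragmentation P X)
    (hb : Function.Surjective b) (hm : ∀ j, (Finset.univ.filter fun i => b i = j).card = m j)
    (hk : 2 ≤ k) {t : ℝ} (ht : t ∈ Ico (0 : ℝ) 1) : jumpKernel m t t ≤ survivalRate n t := by
  have hn : 0 < n := (hb ⟨0, by omega⟩).choose.pos
  have h1 := (hasDerivWithinAt_iff_tendsto_slope' self_notMem_Ioi).1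
    (hX.hasDerivWithinAt_jumpMeasure_Ioc hb hm hk ht)
  have h2 := (hasDerivWithinAt_iff_tendsto_slope' self_notMem_Ioi).1
    ((hasDerivAt_survival n t).neg.hasDerivWithinAt (s := Ioi t))
  rw [neg_neg] at h2
  refine le_of_tendsto_of_tendsto h1 h2 ?_
  filter_upwards [Ioo_mem_nhdsGT ht.2] with y hy
  rw [slope_def_field, slope_def_field, jumpMeasure_Ioc_sub X _ ht.1 hy.1.le]
  refine div_le_div_of_nonneg_right ?_ (sub_pos.2 hy.1).le
  have := hX.jumpMeasure_Ioc_le hn (Setoid.ker b) ht.1 hy.1.le hy.2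
  simp only [Pi.neg_apply]
  linarith

theorem jumpMeasure_eq (hX : IsRuelleFragmentation P X)
    (hb : Function.Surjective b) (hm : ∀ j, (Finset.univ.filter fun i => b i = j).card = m j)
    (hk : 2 ≤ k) {A : Set ℝ} (hA : A ⊆ Ico 0 1) (hAm : MeasurableSet A) :
    jumpMeasure P X (Setoid.ker b) A = ∫⁻ t in A, ENNReal.ofReal (jumpKernel m t t) := by
  have hn : 0 < n := (hb ⟨0, by omega⟩).choose.pos
  refine measure_eq_setLIntegral_of_hasDerivWithinAt
    (F := fun t => (jumpMeasure P X (Setoid.ker b)).real (Ioc 0 t))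
    ((continuous_jumpKernel m).comp (continuous_id.prodMk continuous_id)).continuousOn
    (fun t ht => jumpKernel_self_nonneg m ht) (fun t _ => (ofReal_measureReal).symm)
    (by simp) (hX.continuousOn_jumpMeasure_Ioc hn _)
    (fun t ht => hX.hasDerivWithinAt_jumpMeasure_Ioc hb hm hk ⟨ht.1.le, ht.2⟩) ?_ hA hAm
  exact le_antisymm ((hX.jumpMeasure_le _ (measurableSet_singleton 0)).trans_eq
    (hX.map_firstJumpTime_zero hn)) zero_le

theorem tendsto_cond_firstJump (hX : IsRuelleFragmentation P X)
    (hb : Function.Surjective b) (hm : ∀ j, (Finset.univ.filter fun i => b i = j).card = m j)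
    (hk : 2 ≤ k) (hn : 2 ≤ n) {t : ℝ} (ht : t ∈ Ico (0 : ℝ) 1) :
    Tendsto (fun s : ℝ => s⁻¹ * (P[|{ω | t ≤ firstJumpTime X n ω}]).real
        {ω | firstJumpTime X n ω ∈ Icc t (t + s) ∧
          partitionRestrict n (X (firstJumpTime X n ω) ω) = Setoid.ker b})
      (𝓝[>] 0) (𝓝 (jumpKernel m t t / survival n t)) := by
  have hslope := (hasDerivWithinAt_iff_tendsto_slope' self_notMem_Ioi).1
    (hX.hasDerivWithinAt_jumpMeasure_Ioc hb hm hk ht)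
  have hshift : Tendsto (fun s : ℝ => t + s) (𝓝[>] 0) (𝓝[>] t) := by
    refine tendsto_nhdsWithin_iff.2 ⟨?_, ?_⟩
    · have : Tendsto (fun s : ℝ => t + s) (𝓝 0) (𝓝 (t + 0)) :=
        tendsto_const_nhds.add tendsto_id
      rw [add_zero] at this
      exact this.mono_left nhdsWithin_le_nhds
    · filter_upwards [self_mem_nhdsWithin] with s hs
      exact lt_add_of_pos_right t hs
  refine ((hslope.comp hshift).div_const (survival n t)).congr' ?_
  filter_upwards [self_mem_nhdsWithin] with s hs
  have hs0 : 0 < s := hs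
  have hnull : NullMeasurableSet {ω | t ≤ firstJumpTime X n ω} P :=
    (hX.aemeasurable_firstJumpTime n).nullMeasurableSet_preimage measurableSet_Ici
  -- The closed interval may be replaced by (t, t+s], since τ has no atom at t.
  have h1 : P.real ({ω | firstJumpTime X n ω ∈ Icc t (t + s) ∧
      partitionRestrict n (X (firstJumpTime X n ω) ω) = Setoid.ker b} ∩
        {ω | t ≤ firstJumpTime X n ω}) =
      (jumpMeasure P X (Setoid.ker b)).real (Ioc t (t + s)) := by
    rw [Measure.real, Measure.real, hX.jumpMeasure_apply _ measurableSet_Ioc]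
    refine congrArg ENNReal.toReal (measure_congr ?_)
    filter_upwards [measure_eq_zero_iff_ae_notMem.1 (hX.measure_firstJumpTime_eq hn ht)] with ω hω
    refine propext ⟨fun h => ⟨⟨lt_of_le_of_ne h.2 fun h' => hω h'.symm, h.1.1.2⟩, h.1.2⟩,
      fun h => ⟨⟨⟨h.1.1.le, h.1.2⟩, h.2⟩, h.1.1.le⟩⟩
  have h2 : (P[|{ω | t ≤ firstJumpTime X n ω}]).real
        {ω | firstJumpTime X n ω ∈ Icc t (t + s) ∧
          partitionRestrict n (X (firstJumpTime X n ω) ω) = Setoid.ker b} =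
      (survival n t)⁻¹ * (jumpMeasure P X (Setoid.ker b)).real (Ioc t (t + s)) := by
    rw [← h1, ← hX.measureReal_le_firstJumpTime hn ht, ProbabilityTheory.cond, Measure.real,
      Measure.smul_apply, Measure.restrict_apply₀' hnull, smul_eq_mul, ENNReal.toReal_mul,
      ENNReal.toReal_inv]
    rfl
  rw [Function.comp_apply, slope_def_field, jumpMeasure_Ioc_sub X _ ht.1 (by linarith), h2,
    add_sub_cancel_left]
  ring

theorem isInstantaneousJumpRate (hX : IsRuelleFragmentation P X)
    (hb : Function.Surjective b) (hm : ∀ j, (Finset.univ.filter fun i => b i = j).card = m j)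
    (hk : 2 ≤ k) (hn : 2 ≤ n) :
    IsInstantaneousJumpRate P X (Setoid.ker b) fun t => jumpKernel m t t / survival n t where
  survival_pos t ht := by
    have h := hX.measureReal_le_firstJumpTime hn ht
    have h' := survival_pos n ht.2
    rw [← h] at h'
    exact pos_iff_ne_zero.2 fun h0 => by simp [Measure.real, h0] at h'
  jump_lt_one := hX.ae_firstJumpTime_lt_one hn
  density := by
    have hcont : Continuous fun t => jumpKernel m t t :=
      (continuous_jumpKernel m).comp (continuous_id.prodMk continuous_id)
    -- The conditional probability is the ratio of the two densities, continuous because the density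
    -- of τ is positive on [0, 1) when n ≥ 2.
    refine ⟨survivalRate n, fun t => jumpKernel m t t / survivalRate n t,
      (continuous_survivalRate n).continuousOn, fun t ht => (survivalRate_pos hn ht.2).le,
      fun A hA hAm => ?_, hcont.continuousOn.div (continuous_survivalRate n).continuousOn
        fun t ht => (survivalRate_pos hn ht.2).ne', fun t ht => ⟨?_, ?_⟩, fun A hA hAm => ?_,
      fun t ht => ?_⟩
    · rw [← hX.map_firstJumpTime_eq hn hA hAm,
        Measure.map_apply_of_aemeasurable (hX.aemeasurable_firstJumpTime n) hAm]
      rfl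
    · exact div_nonneg (jumpKernel_self_nonneg m ht) (survivalRate_pos hn ht.2).le
    · exact div_le_one_of_le₀ (hX.jumpKernel_le_survivalRate hb hm hk ht)
        (survivalRate_pos hn ht.2).le
    · rw [← hX.jumpMeasure_apply _ hAm, hX.jumpMeasure_eq hb hm hk hA hAm]
      refine setLIntegral_congr_fun hAm fun t ht => ?_
      dsimp only
      rw [div_mul_cancel₀ _ (survivalRate_pos hn (hA ht).2).ne']
    · rw [hX.measureReal_le_firstJumpTime hn ht, div_mul_div_cancel₀ (survivalRate_pos hn ht.2).ne']
  limit t ht := hX.tendsto_cond_firstJump hb hm hk hn ht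

end Kernel

end IsRuelleFragmentation

/-! ### Enumerated blocks and the jump rate formula -/

/-- The index of the block of an element, for an enumeration `B` of the blocks of a partition. -/
theorem exists_ker_eq {n k : ℕ} (π : Setoid (Fin n)) (B : Fin k → Set (Fin n))
    (hB : Function.Injective B) (hBπ : range B = π.classes) :
    ∃ b : Fin n → Fin k, Function.Surjective b ∧ Setoid.ker b = π ∧
      ∀ j, (Finset.univ.filter fun i => b i = j).card = (B j).ncard := by
  have hex : ∀ i, ∃ j, B j = {x | π x i} := fun i => by
    have : {x | π x i} ∈ range B := by rw [hBπ]; exact ⟨i, rfl⟩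
    exact this
  choose b hb using hex
  have hmem : ∀ i j, i ∈ B j ↔ b i = j := by
    intro i j
    constructor
    · intro h
      have hj : B j ∈ π.classes := by rw [← hBπ]; exact ⟨j, rfl⟩
      obtain ⟨y, hy⟩ := hj
      refine hB ((hb i).trans (Eq.trans ?_ hy.symm))
      rw [hy] at h
      ext x
      exact ⟨fun hx => π.trans' hx h, fun hx => π.trans' hx (π.symm' h)⟩
    · rintro rfl
      rw [hb]
      exact π.refl' i
  refine ⟨b, fun j => ?_, ?_, fun j => ?_⟩
  · have hj : B j ∈ π.classes := by rw [← hBπ]; exact ⟨j, rfl⟩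
    obtain ⟨y, hy⟩ := hj
    refine ⟨y, (hmem y j).1 ?_⟩
    rw [hy]
    exact π.refl' y
  · refine Setoid.ext fun i j => ?_
    rw [Setoid.ker_def, ← hmem, hb]
    rfl
  · rw [← ncard_coe_finset]
    congr 1
    ext i
    simp [hmem]

theorem proposition4p1 {Ω : Type*} [MeasurableSpace Ω] (P : Measure Ω) [IsProbabilityMeasure P]
    (X : ℝ → Ω → Setoid ℕ) (hX : IsRuelleFragmentation P X)
    (n : ℕ) (π : Setoid (Fin n)) (hπ : π ≠ ⊤)
    (k : ℕ) (B : Fin k → Set (Fin n)) (hB : Function.Injective B) (hBπ : range B = π.classes) :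
    ∃ q : ℝ → ℝ, IsInstantaneousJumpRate P X π q ∧
      (∀ t ∈ Ioo (0 : ℝ) 1,
        0 < eppf (paintBoxLaw (poissonDirichlet t 0)) ![n] ∧
        q t = eppf (paintBoxLaw (poissonDirichlet t 0)) (fun i => (B i).ncard) /
          (t * ((k : ℝ) - 1) * eppf (paintBoxLaw (poissonDirichlet t 0)) ![n])) ∧
      Tendsto (fun t : ℝ =>
          eppf (paintBoxLaw (poissonDirichlet t 0)) (fun i => (B i).ncard) /
            (t * ((k : ℝ) - 1) * eppf (paintBoxLaw (poissonDirichlet t 0)) ![n]))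
        (𝓝[>] 0) (𝓝 (q 0)) := by
  obtain ⟨b, hb, hker, hm⟩ := exists_ker_eq π B hB hBπ
  obtain ⟨i, j, hij⟩ : ∃ i j, ¬ π i j := by
    by_contra! h
    exact hπ (Setoid.ext fun i j => ⟨fun _ => trivial, fun _ => h i j⟩)
  have hbij : b i ≠ b j := fun h => hij (by rw [← hker]; exact h)
  have hk : 2 ≤ k := by
    have h1 := (b i).2
    have h2 := (b j).2
    have h3 : (b i : ℕ) ≠ b j := fun h => hbij (Fin.ext h)
    omega
  have hn : 2 ≤ n := by
    have h1 := i.2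
    have h2 := j.2
    have h3 : (i : ℕ) ≠ j := fun h => hbij (congrArg b (Fin.ext h))
    omega
  set m : Fin k → ℕ := fun i => (B i).ncard
  have hpos : ∀ j, 0 < m j := fun j => by
    obtain ⟨i, hi⟩ := hb j
    exact (Finset.card_pos.2 ⟨i, by simp [hi]⟩).trans_eq (hm j)
  -- Time 0 is excluded: the quotient has a factor t in its denominator, and the sampling formula is
  -- used with first parameter t > 0.
  have hformula : ∀ t ∈ Ioo (0 : ℝ) 1,
      eppf (paintBoxLaw (poissonDirichlet t 0)) ![n] = survival n t ∧
      jumpKernel m t t / survival n t = eppf (paintBoxLaw (poissonDirichlet t 0)) m /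
          (t * ((k : ℝ) - 1) * eppf (paintBoxLaw (poissonDirichlet t 0)) ![n]) := by
    intro t ht
    have h1 : eppf (paintBoxLaw (poissonDirichlet t 0)) ![n] = survival n t := by
      rw [eppf_poissonDirichlet ht.1 ht.2 (by linarith [ht.1]) _ fun j => by
        simp only [Matrix.cons_val_fin_one]; omega, pitmanEPPF_zero_singleton]
    refine ⟨h1, ?_⟩
    rw [h1, eppf_poissonDirichlet ht.1 ht.2 (by linarith [ht.1]) m hpos, pitmanEPPF_zero_eq hk]
    have hk' : (0 : ℝ) < (k : ℝ) - 1 := by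
      have : (2 : ℝ) ≤ k := by exact_mod_cast hk
      linarith
    rw [mul_div_mul_left _ _ (mul_pos ht.1 hk').ne']
  refine ⟨fun t => jumpKernel m t t / survival n t, ?_, fun t ht => ?_, ?_⟩
  · rw [← hker]
    exact hX.isInstantaneousJumpRate hb hm hk hn
  · exact ⟨(hformula t ht).1 ▸ survival_pos n ht.2, (hformula t ht).2⟩
  -- After the common factor t(k-1) is cancelled, the rate is a quotient of polynomials continuous
  -- at 0, where the survival function is positive.
  · have hcont : ContinuousAt (fun t => jumpKernel m t t / survival n t) 0 :=
      ContinuousAt.div ((continuous_jumpKernel m).comp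
        (continuous_id.prodMk continuous_id)).continuousAt (continuous_survival n).continuousAt
        (survival_pos n zero_lt_one).ne'
    refine (hcont.tendsto.mono_left nhdsWithin_le_nhds).congr' ?_
    filter_upwards [Ioo_mem_nhdsGT zero_lt_one] with t ht
    exact (hformula t ht).2
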